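/- \textbf{Conventions.} Formulas are first-order formulas with primitive connectives $\wedge,\vee,\Rightarrow,\neg,\forall,\exists$; bound and free variables are distinct. Some function symbols are called Skolem symbols. The $\alpha$-formulas are $A\wedge B$, $\neg(A\vee B)$, $\neg(A\Rightarrow B)$, $\neg\neg A$, with components $\{A,B\}$, $\{\neg A,\neg B\}$, $\{A,\neg B\}$, $\{A\}$; the $\beta$-formulas are $A\vee B$, $A\Rightarrow B$, $\neg(A\wedge B)$, with components $A\mid B$, $\neg A\mid B$, $\neg A\mid\neg B$; the $\gamma$-formulas are $\forall x\,D$ and $\neg\exists x\,D$, and the $\delta$-formulas are $\exists x\,D$ and $\neg\forall x\,D$, with instances $D(t)$, respectively $\neg D(t)$. \textbf{Tableaux.} A (strict) tableau rooted at a finite multiset $\Gamma$ of formulas is a finite tree whose nodes are finite multisets of formulas. Each rule applies to a formula of a node and adds new formulas to it (nothing is removed): the $\alpha$-rule adds the components, the $\beta$-rule has two premises $b.0$, $b.1$, each adding one component, the $\gamma$-rule adds the instance by a fresh free variable, the $\delta$-rule adds the instance by $f(x_1,\dots,x_n)$, where $f$ is a fresh Skolem symbol and $x_1,\dots,x_n$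 are the free variables of the formula; the closure rule closes a node that contains $A$ and $\neg B$ under the constraint $A\approx B$, and has no premise. Leaves to which no rule is applied are open. A \emph{closed tableau} $(T,\sigma)$ is a tableau $T$ rooted at $\Gamma$ without open leaves, with a ground substitution $\sigma$ (mapping free variables to terms without variables) such that $\sigma A=\sigma B$ for all closure constraints of $T$, and such that no Skolem symbol occurs in $\sigma\Gamma$ (as is the case when $\Gamma$ consists of closed formulas without Skolem symbols). An \emph{initial part} of a tree is obtained by replacing some of its subtrees by open leaves with the same formulas. \textbf{GS3.} Sequents $\Gamma\vdash$ are finite multisets of formulas without free variables. The rules, read from conclusion to premises, are weakening (remove one formula), the axiom rule (close a sequent that contains $A$ and $\neg A$), and the $\alpha$-, $\beta$-, $\gamma$-, $\delta$-rules, which keep the active formula and add the components, respectively an instance by any ground term ($\gamma$) or by a constant or Skolem term (a ground term whose head is a Skolem symbol) that does not occur in the conclusion, even as a subterm ($\delta$). A proof tree may have open leaves. \textbf{Links.} A proof tree $\pi$ is \emph{linked} to $(T_0,\sigma)$ by $\mu$ if $T_0$ is rooted at some $\Gamma$ and $\pi$ at $\sigma\Gamma$, and $\mu$ maps each open leaf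 $s$ of $\pi$ to an open leaf $\mu(s)$ of $T_0$ such that every formula of $\sigma\Delta_{\mu(s)}$ is in $\Gamma_s$, where $\Delta_{\mu(s)}$ and $\Gamma_s$ are the formulas of the two leaves. \textbf{Theorem (parallel extension).} Let $(T,\sigma)$ be a closed tableau, $T_0$ an initial part of $T$, and $\pi_0$ a GS3 proof tree linked to $(T_0,\sigma)$ by $\mu_0$. Let $b$ be any open leaf of $T_0$. Then $T$ applies some rule $r$ at $b$; let $T_1$ be the extension of $T_0$ by $r$ at $b$. There are a GS3 proof tree $\pi_1$ and a map $\mu_1$ that form a parallel extension of $\pi_0$ along $T_1$, that is: \begin{itemize} \item $\pi_0$ is an initial part of $\pi_1$, and $\pi_1$ is linked to $(T_1,\sigma)$ by $\mu_1$; \item each open leaf $s$ of $\pi_0$ with $\mu_0(s)\neq b$ is still an open leaf of $\pi_1$, and $\mu_1(s)=\mu_0(s)$ for every common open leaf $s$ of $\pi_0$ and $\pi_1$; \item each open leaf of $\pi_1$ that is not an open leaf of $\pi_0$ lies above some open leaf $s_0$ of $\pi_0$ with $\mu_0(s_0)=b$, and $\mu_1$ maps it to a premise $b.i$ of $r$ in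 $T_1$; \item for each open leaf $s_0$ of $\pi_0$ with $\mu_0(s_0)=b$ and each premise $b.i$ of $r$ in $T_1$, some open leaf of $\pi_1$ above $s_0$ is mapped to $b.i$. \end{itemize} Moreover, if $r$ is an $\alpha$-, $\beta$-, $\gamma$- or closure rule, the extension can be chosen direct: at each open leaf $s_0$ of $\pi_0$ with $\mu_0(s_0)=b$, the tree $\pi_1$ applies the instance of $r$ by $\sigma$ (the axiom rule if $r$ is a closure rule), its premises $s_0.i$ are open leaves, and $\mu_1(s_0.i)=b.i$. -/

import Mathlib

namespace FVTab

universe u v w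

/-! ### First-order formulas, substitution, occurrences

Terms are Mathlib's first-order terms.  The connectives are all primitive.  The index `n` counts
the bound variables in scope (as in `FirstOrder.Language.BoundedFormula`), `V` is the type of free
variables, so that `Fml L V 0` is the type of formulas, and `Fml L Empty 0` is the type of formulas
without free variables. -/

/-- First-order formulas over the language `L`, with `∧, ∨, ⇒, ¬, ∀, ∃` as primitive symbols. -/
inductive Fml (L : FirstOrder.Language.{u, v}) (V : Type w) : ℕ → Type (max u v w)
  | rel {n k : ℕ} (R : L.Relations k) (ts : Fin k → L.Term (V ⊕ Fin n)) : Fml L V n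
  | neg {n : ℕ} (A : Fml L V n) : Fml L V n
  | and {n : ℕ} (A B : Fml L V n) : Fml L V n
  | or {n : ℕ} (A B : Fml L V n) : Fml L V n
  | imp {n : ℕ} (A B : Fml L V n) : Fml L V n
  | all {n : ℕ} (A : Fml L V (n + 1)) : Fml L V n
  | ex {n : ℕ} (A : Fml L V (n + 1)) : Fml L V n

variable {L : FirstOrder.Language.{u, v}} {V W : Type*}

/-- Passing under a quantifier: the newly bound variable (the last index) is left alone. -/
def liftSubst {n m : ℕ} (f : V ⊕ Fin n → L.Term (W ⊕ Fin m)) :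
    V ⊕ Fin (n + 1) → L.Term (W ⊕ Fin (m + 1)) :=
  Sum.elim
    (fun v => (f (Sum.inl v)).relabel (Sum.map id Fin.castSucc))
    (Fin.lastCases (FirstOrder.Language.Term.var (Sum.inr (Fin.last m)))
      (fun i => (f (Sum.inr i)).relabel (Sum.map id Fin.castSucc)))

/-- Simultaneous capture-avoiding substitution of terms for free and for dangling variables. -/
def Fml.subst {n : ℕ} (A : Fml L V n) :
    {m : ℕ} → (V ⊕ Fin n → L.Term (W ⊕ Fin m)) → Fml L W m :=
  match A with
  | .rel R ts => fun f => .rel R (fun i => (ts i).subst f)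
  | .neg A => fun f => .neg (A.subst f)
  | .and A B => fun f => .and (A.subst f) (B.subst f)
  | .or A B => fun f => .or (A.subst f) (B.subst f)
  | .imp A B => fun f => .imp (A.subst f) (B.subst f)
  | .all A => fun f => .all (A.subst (liftSubst f))
  | .ex A => fun f => .ex (A.subst (liftSubst f))

/-- `D.inst t` is `D(x := t)`, where `x` is the variable that the quantifier in front of `D`
binds. -/
def Fml.inst (D : Fml L V 1) (t : L.Term V) : Fml L V 0 :=
  D.subst (Sum.elim (fun v => FirstOrder.Language.Term.var (Sum.inl v)) (fun _ => t.relabel Sum.inl))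

/-- `A.ground σ` is the instance `σ A` of `A` by the ground substitution `σ`. -/
def Fml.ground (σ : V → L.Term Empty) {n : ℕ} (A : Fml L V n) : Fml L Empty n :=
  A.subst (Sum.elim (fun v => (σ v).relabel Sum.inl)
    (fun i => FirstOrder.Language.Term.var (Sum.inr i)))

/-- `s` is a (not necessarily strict) subterm of the given term. -/
def IsSubterm {β : Type*} (s : L.Term β) : L.Term β → Prop
  | .var x => s = .var x
  | .func f ts => s = .func f ts ∨ ∃ i, IsSubterm s (ts i)

/-- Some argument of some atom of the formula satisfies `p`. -/
def Fml.SomeArg (p : ∀ k : ℕ, L.Term (V ⊕ Fin k) → Prop) : {n : ℕ} → Fml L V n → Prop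
  | n, .rel _ ts => ∃ i, p n (ts i)
  | _, .neg A => A.SomeArg p
  | _, .and A B => A.SomeArg p ∨ B.SomeArg p
  | _, .or A B => A.SomeArg p ∨ B.SomeArg p
  | _, .imp A B => A.SomeArg p ∨ B.SomeArg p
  | _, .all A => A.SomeArg p
  | _, .ex A => A.SomeArg p

/-- The term `t` occurs in the formula, as a subterm of an argument of an atom. -/
def Fml.HasTerm {n : ℕ} (A : Fml L V n) (t : L.Term V) : Prop :=
  A.SomeArg (fun _ u => IsSubterm (t.relabel Sum.inl) u)

/-- The function symbol `f` occurs in the formula. -/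
def Fml.HasFun {n k : ℕ} (A : Fml L V n) (f : L.Functions k) : Prop :=
  A.SomeArg (fun _ u => ∃ ts, IsSubterm (FirstOrder.Language.Term.func f ts) u)

/-- The set of free variables. -/
def Fml.freeVars {n : ℕ} (A : Fml L V n) : Set V :=
  {x | A.HasTerm (FirstOrder.Language.Term.var x)}

/-! ### The classification of formulas -/

/-- `Alpha A As`: `A` is an `α`-formula, with the multiset `As` of components. -/
inductive Alpha : Fml L V 0 → Multiset (Fml L V 0) → Prop
  | and (A B : Fml L V 0) : Alpha (.and A B) {A, B}
  | negOr (A B : Fml L V 0) : Alpha (.neg (.or A B)) {.neg A, .neg B}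
  | negImp (A B : Fml L V 0) : Alpha (.neg (.imp A B)) {A, .neg B}
  | negNeg (A : Fml L V 0) : Alpha (.neg (.neg A)) {A}

/-- `Beta A B C`: `A` is a `β`-formula, with left component `B` and right component `C`. -/
inductive Beta : Fml L V 0 → Fml L V 0 → Fml L V 0 → Prop
  | or (A B : Fml L V 0) : Beta (.or A B) A B
  | imp (A B : Fml L V 0) : Beta (.imp A B) (.neg A) B
  | negAnd (A B : Fml L V 0) : Beta (.neg (.and A B)) (.neg A) (.neg B)

/-- `Gamma A D`: `A` is a `γ`-formula, with instances `D(x := t)`. -/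
inductive Gamma : Fml L V 0 → Fml L V 1 → Prop
  | all (D : Fml L V 1) : Gamma (.all D) D
  | negEx (D : Fml L V 1) : Gamma (.neg (.ex D)) (.neg D)

/-- `Delta A D`: `A` is a `δ`-formula, with instances `D(x := t)`. -/
inductive Delta : Fml L V 0 → Fml L V 1 → Prop
  | ex (D : Fml L V 1) : Delta (.ex D) D
  | negAll (D : Fml L V 1) : Delta (.neg (.all D)) (.neg D)

/-! ### Derivation trees -/

/-- Positions in trees: sequences of `0` (`false`, left or only child) and `1` (`true`, right
child). -/
abbrev Pos := List Bool

/-- Trees whose nodes carry an `S` (the formulas of the node), and whose inner nodes also carry the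
rule that is applied there.  A constructor `leaf` is an open leaf; a `node0` is a node that has
been closed by a rule without premises. -/
inductive DTree (S R : Type*)
  | leaf (s : S) : DTree S R
  | node0 (s : S) (r : R) : DTree S R
  | node1 (s : S) (r : R) (t : DTree S R) : DTree S R
  | node2 (s : S) (r : R) (t u : DTree S R) : DTree S R

namespace DTree

variable {S R : Type*}

/-- The label of the root. -/
def root : DTree S R → S
  | leaf s => s
  | node0 s _ => s
  | node1 s _ _ => s
  | node2 s _ _ _ => s

/-- Every inner node is a correct inference, where `step r s ps` says that the rule `r`, applied to
`s`, has the list of premises `ps`. -/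
def Valid (step : R → S → List S → Prop) : DTree S R → Prop
  | leaf _ => True
  | node0 s r => step r s []
  | node1 s r t => step r s [t.root] ∧ t.Valid step
  | node2 s r t u => step r s [t.root, u.root] ∧ t.Valid step ∧ u.Valid step

/-- All rules of the tree, one entry for each inner node. -/
def rules : DTree S R → List R
  | leaf _ => []
  | node0 _ r => [r]
  | node1 _ r t => r :: t.rules
  | node2 _ r t u => r :: (t.rules ++ u.rules)

/-- The tree has no open leaf. -/
def Closed : DTree S R → Prop
  | leaf _ => False
  | node0 _ _ => True
  | node1 _ _ t => t.Closed
  | node2 _ _ t u => t.Closed ∧ u.Closed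

/-- The label of the open leaf at a position; `none` if there is no open leaf there. -/
def leafAt : DTree S R → Pos → Option S
  | leaf s, [] => some s
  | node1 _ _ t, false :: p => t.leafAt p
  | node2 _ _ t _, false :: p => t.leafAt p
  | node2 _ _ _ u, true :: p => u.leafAt p
  | _, _ => none

/-- There is an open leaf at the position `p`. -/
def IsLeaf (t : DTree S R) (p : Pos) : Prop := ∃ s, t.leafAt p = some s

/-- The rule that is applied at a position; `none` if there is no inner node there. -/
def ruleAt : DTree S R → Pos → Option R
  | node0 _ r, [] => some r
  | node1 _ r _, [] => some r
  | node2 _ r _ _, [] => some r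
  | node1 _ _ t, false :: p => t.ruleAt p
  | node2 _ _ t _, false :: p => t.ruleAt p
  | node2 _ _ _ u, true :: p => u.ruleAt p
  | _, _ => none

/-- `Initial t t'`: the tree `t` is an initial part of `t'`: it has the same root, and it is an
open leaf, or the same rule is applied at both roots and the subtrees of `t` are initial parts of
those of `t'`. -/
inductive Initial : DTree S R → DTree S R → Prop
  | leaf (t : DTree S R) : Initial (leaf t.root) t
  | node0 (s : S) (r : R) : Initial (node0 s r) (node0 s r)
  | node1 (s : S) (r : R) {t t' : DTree S R} (h : Initial t t') :
      Initial (node1 s r t) (node1 s r t')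
  | node2 (s : S) (r : R) {t t' u u' : DTree S R} (h : Initial t t') (k : Initial u u') :
      Initial (node2 s r t u) (node2 s r t' u')

/-- The first inference of a tree, with open leaves as its premises. -/
def firstStep : DTree S R → DTree S R
  | leaf s => leaf s
  | node0 s r => node0 s r
  | node1 s r t => node1 s r (leaf t.root)
  | node2 s r t u => node2 s r (leaf t.root) (leaf u.root)

/-- `t₀.extend t b`: the extension of the initial part `t₀` of `t` by the rule that `t` applies at
the position `b`, when `b` is an open leaf of `t₀`. -/
def extend : DTree S R → DTree S R → Pos → DTree S R
  | leaf _, t, [] => t.firstStep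
  | node1 s r t₀, node1 _ _ t, false :: b => node1 s r (t₀.extend t b)
  | node2 s r t₀ u₀, node2 _ _ t _, false :: b => node2 s r (t₀.extend t b) u₀
  | node2 s r t₀ u₀, node2 _ _ _ u, true :: b => node2 s r t₀ (u₀.extend u b)
  | t₀, _, _ => t₀

end DTree

/-! ### Free-variable tableaux with on-the-fly inner Skolemization -/

/-- Tableau rules.  `closure A B` closes a branch that carries `A` and `¬ B`, under the constraint
`A ≈ B`; `gamma A D x` instantiates the `γ`-formula `A` by the free variable `x`;
`delta A D f args` instantiates the `δ`-formula `A` by the Skolem term `f(args)`. -/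
inductive TabRule (L : FirstOrder.Language.{u, v}) (V : Type w) : Type (max u v w)
  | closure (A B : Fml L V 0)
  | alpha (A : Fml L V 0) (As : Multiset (Fml L V 0))
  | beta (A B C : Fml L V 0)
  | gamma (A : Fml L V 0) (D : Fml L V 1) (x : V)
  | delta (A : Fml L V 0) (D : Fml L V 1) {k : ℕ} (f : L.Functions k) (args : Fin k → V)

/-- The (non-destructive) inferences of the tableau calculus; `Sk` is the set of Skolem symbols.
The arguments of a Skolem symbol are the free variables of the Skolemized formula, each once. -/
def TabRule.Step (Sk : ∀ k, Set (L.Functions k)) :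
    TabRule L V → Multiset (Fml L V 0) → List (Multiset (Fml L V 0)) → Prop
  | closure A B, Δ, ps => A ∈ Δ ∧ Fml.neg B ∈ Δ ∧ ps = []
  | alpha A As, Δ, ps => Alpha A As ∧ A ∈ Δ ∧ ps = [As + Δ]
  | beta A B C, Δ, ps => Beta A B C ∧ A ∈ Δ ∧ ps = [B ::ₘ Δ, C ::ₘ Δ]
  | gamma A D x, Δ, ps => Gamma A D ∧ A ∈ Δ ∧ ps = [D.inst (.var x) ::ₘ Δ]
  | delta (k := k) A D f args, Δ, ps =>
      Delta A D ∧ A ∈ Δ ∧ f ∈ Sk k ∧ Function.Injective args ∧ Set.range args = D.freeVars ∧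
        ps = [D.inst (.func f (fun i => .var (args i))) ::ₘ Δ]

/-- The free variable that a rule introduces. -/
def TabRule.newVar : TabRule L V → Option V
  | gamma _ _ x => some x
  | _ => none

/-- The Skolem symbol that a rule introduces. -/
def TabRule.newSym : TabRule L V → Option (Σ k, L.Functions k)
  | delta (k := k) _ _ f _ => some ⟨k, f⟩
  | _ => none

/-- `δ`-rules. -/
def TabRule.IsDelta : TabRule L V → Prop
  | delta _ _ _ _ => True
  | _ => False

/-- Tableau trees: the nodes carry the formulas of the tableau branches. -/
abbrev TabTree (L : FirstOrder.Language.{u, v}) (V : Type w) :=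
  DTree (Multiset (Fml L V 0)) (TabRule L V)

/-- `T` is a strict tableau (one without a unifier) rooted at `Γ`: its inferences are correct, each
`γ`-rule introduces a fresh free variable, and each `δ`-rule introduces a fresh Skolem symbol. -/
structure IsTableau (Sk : ∀ k, Set (L.Functions k)) (Γ : Multiset (Fml L V 0))
    (T : TabTree L V) : Prop where
  root_eq : T.root = Γ
  valid : T.Valid (TabRule.Step Sk)
  newVar_nodup : (T.rules.filterMap TabRule.newVar).Nodup
  newVar_fresh : ∀ x ∈ T.rules.filterMap TabRule.newVar, ∀ A ∈ Γ, x ∉ A.freeVars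
  newSym_nodup : (T.rules.filterMap TabRule.newSym).Nodup
  newSym_fresh : ∀ f ∈ T.rules.filterMap TabRule.newSym, ∀ A ∈ Γ, ¬ A.HasFun f.2

/-- The ground substitution `σ` satisfies all constraints `A ≈ B` of the closure rules of `T`. -/
def Unifies (σ : V → L.Term Empty) (T : TabTree L V) : Prop :=
  ∀ A B : Fml L V 0, TabRule.closure A B ∈ T.rules → A.ground σ = B.ground σ

/-- `(T, σ)` is a closed tableau rooted at `Γ`: all branches of the strict tableau `T` are closed,
the ground substitution `σ` unifies all closing constraints at once, and `σ Γ` contains no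
Skolem symbol. -/
structure IsClosedTableau (Sk : ∀ k, Set (L.Functions k)) (Γ : Multiset (Fml L V 0))
    (T : TabTree L V) (σ : V → L.Term Empty) : Prop where
  isTableau : IsTableau Sk Γ T
  closed : T.Closed
  unifies : Unifies σ T
  noSkolem : ∀ A ∈ Γ, ∀ k, ∀ f ∈ Sk k, ¬ (A.ground σ).HasFun f

/-! ### The sequent calculus GS3

Sequents are multisets of formulas without free variables, on the left of the turnstile. -/

/-- The rules of GS3; `weak` is weakening. -/
inductive GSRule (L : FirstOrder.Language.{u, v}) : Type (max u v)
  | ax (A : Fml L Empty 0)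
  | weak (A : Fml L Empty 0)
  | alpha (A : Fml L Empty 0) (As : Multiset (Fml L Empty 0))
  | beta (A B C : Fml L Empty 0)
  | gamma (A : Fml L Empty 0) (D : Fml L Empty 1) (t : L.Term Empty)
  | delta (A : Fml L Empty 0) (D : Fml L Empty 1) (c : L.Term Empty)

/-- The terms that are allowed as witnesses in the `δ`-rules of GS3: constants, and Skolem terms,
which are treated as constants. -/
def IsWitness (Sk : ∀ k, Set (L.Functions k)) (c : L.Term Empty) : Prop :=
  ∃ (k : ℕ) (f : L.Functions k) (ts : Fin k → L.Term Empty),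
    c = .func f ts ∧ (k = 0 ∨ f ∈ Sk k)

/-- The inferences of GS3.  The witness of a `δ`-rule is fresh: it does not occur in the
conclusion, not even as a subterm of another term. -/
def GSRule.Step (Sk : ∀ k, Set (L.Functions k)) :
    GSRule L → Multiset (Fml L Empty 0) → List (Multiset (Fml L Empty 0)) → Prop
  | ax A, Δ, ps => A ∈ Δ ∧ Fml.neg A ∈ Δ ∧ ps = []
  | weak A, Δ, ps => ∃ Δ', Δ = A ::ₘ Δ' ∧ ps = [Δ']
  | alpha A As, Δ, ps => Alpha A As ∧ A ∈ Δ ∧ ps = [As + Δ]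
  | beta A B C, Δ, ps => Beta A B C ∧ A ∈ Δ ∧ ps = [B ::ₘ Δ, C ::ₘ Δ]
  | gamma A D t, Δ, ps => Gamma A D ∧ A ∈ Δ ∧ ps = [D.inst t ::ₘ Δ]
  | delta A D c, Δ, ps =>
      Delta A D ∧ A ∈ Δ ∧ IsWitness Sk c ∧ (∀ B ∈ Δ, ¬ B.HasTerm c) ∧ ps = [D.inst c ::ₘ Δ]

/-- GS3 trees: the nodes carry sequents. -/
abbrev GSTree (L : FirstOrder.Language.{u, v}) :=
  DTree (Multiset (Fml L Empty 0)) (GSRule L)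

/-- `π` is a (possibly open) GS3 proof tree. -/
def IsProofTree (Sk : ∀ k, Set (L.Functions k)) (π : GSTree L) : Prop :=
  π.Valid (GSRule.Step Sk)

/-- The instance by `σ` of a tableau rule, as a rule of GS3. -/
def TabRule.toGS (σ : V → L.Term Empty) : TabRule L V → GSRule L
  | closure A _ => .ax (A.ground σ)
  | alpha A As => .alpha (A.ground σ) (As.map (Fml.ground σ))
  | beta A B C => .beta (A.ground σ) (B.ground σ) (C.ground σ)
  | gamma A D x => .gamma (A.ground σ) (D.ground σ) (σ x)
  | delta A D f args => .delta (A.ground σ) (D.ground σ) (.func f (fun i => σ (args i)))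

/-! ### Links and parallel extensions -/

/-- The tree `π` is linked to `(T, σ)` by `μ`: they have the same root (up to `σ`), and `μ` maps
each open leaf `s` of `π` to an open leaf of `T`, such that `σ Δ ⊆ Γ_s` for the formulas `Δ` of
`μ s` and the sequent `Γ_s` of `s`.  (Only the values of `μ` at open leaves matter.) -/
structure Linked (σ : V → L.Term Empty) (π : GSTree L) (T : TabTree L V)
    (μ : Pos → Pos) : Prop where
  root_eq : π.root = T.root.map (Fml.ground σ)
  leaf : ∀ s Γs, π.leafAt s = some Γs →
    ∃ Δ, T.leafAt (μ s) = some Δ ∧ Δ.map (Fml.ground σ) ⊆ Γs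

/-- `π₁`, with the mapping `μ₁`, is a parallel extension of `π₀`, which is linked by `μ₀`, along
the tableau `T₁`, which extends a tableau by a rule at its open leaf `b`.

The tree `π₁` extends `π₀`, it is a proof tree, and it is linked to `(T₁, σ)`.  The open leaves
that are not linked to `b` are kept, `μ₁` is equal to `μ₀` on the old leaves, and the new leaves are
above the leaves that were linked to `b` and are mapped to the premises of the rule (the open leaves
`b.0`, `b.1` of `T₁`).  Above each leaf linked to `b`, each premise is the image of some new leaf. -/
structure IsParallelExtension (Sk : ∀ k, Set (L.Functions k)) (σ : V → L.Term Empty)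
    (π₀ : GSTree L) (μ₀ : Pos → Pos) (b : Pos) (T₁ : TabTree L V)
    (π₁ : GSTree L) (μ₁ : Pos → Pos) : Prop where
  isProofTree : IsProofTree Sk π₁
  initial : π₀.Initial π₁
  linked : Linked σ π₁ T₁ μ₁
  keep : ∀ s, π₀.IsLeaf s → μ₀ s ≠ b → π₁.IsLeaf s
  old : ∀ s, π₀.IsLeaf s → π₁.IsLeaf s → μ₁ s = μ₀ s
  new : ∀ s, π₁.IsLeaf s → ¬ π₀.IsLeaf s →
    (∃ s₀, π₀.IsLeaf s₀ ∧ μ₀ s₀ = b ∧ s₀ <+: s) ∧ ∃ i, μ₁ s = b ++ [i]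
  cover : ∀ s₀, π₀.IsLeaf s₀ → μ₀ s₀ = b → ∀ i, T₁.IsLeaf (b ++ [i]) →
    ∃ s, π₁.IsLeaf s ∧ s₀ <+: s ∧ μ₁ s = b ++ [i]

/-- The parallel extension is direct: the instance by `σ` of the rule `r` is applied, once, at each
leaf that is linked to `b`, and its premises are linked to those of `r`. -/
def IsDirect (σ : V → L.Term Empty) (π₀ : GSTree L) (μ₀ : Pos → Pos) (b : Pos)
    (r : TabRule L V) (T₁ : TabTree L V) (π₁ : GSTree L) (μ₁ : Pos → Pos) : Prop :=
  ∀ s₀, π₀.IsLeaf s₀ → μ₀ s₀ = b →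
    π₁.ruleAt s₀ = some (r.toGS σ) ∧
    ∀ i, T₁.IsLeaf (b ++ [i]) → π₁.IsLeaf (s₀ ++ [i]) ∧ μ₁ (s₀ ++ [i]) = b ++ [i]

end FVTab

namespace FVTab

universe u v w

variable {L : FirstOrder.Language.{u, v}} {V W X : Type*}

open FirstOrder.Language (Term)

/-! ### Terms -/

theorem Term.subst_relabel {α β γ : Type*} (t : L.Term α) (r : α → β) (s : β → L.Term γ) :
    (t.relabel r).subst s = t.subst (s ∘ r) := by
  induction t with
  | var => rfl
  | func f ts ih => simp only [Term.relabel, Term.subst, ih]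

theorem Term.relabel_subst {α β γ : Type*} (t : L.Term α) (s : α → L.Term β) (r : β → γ) :
    (t.subst s).relabel r = t.subst (fun x => (s x).relabel r) := by
  induction t with
  | var => rfl
  | func f ts ih => simp only [Term.relabel, Term.subst, ih]

theorem Term.subst_subst {α β γ : Type*} (t : L.Term α) (s : α → L.Term β) (r : β → L.Term γ) :
    (t.subst s).subst r = t.subst (fun x => (s x).subst r) := by
  induction t with
  | var => rfl
  | func f ts ih => simp only [Term.subst, ih]

/-- The height of a term. -/
def height {β : Type*} : L.Term β → ℕ
  | .var _ => 0
  | .func _ ts => (Finset.univ.sup fun i => height (ts i)) + 1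

theorem height_lt_func {β : Type*} {k : ℕ} (f : L.Functions k) (ts : Fin k → L.Term β)
    (i : Fin k) : height (ts i) < height (.func f ts) :=
  Nat.lt_succ_of_le (Finset.le_sup (f := fun i => height (ts i)) (Finset.mem_univ i))

theorem height_func_le {β : Type*} {k l : ℕ} (f : L.Functions k) (ts : Fin k → L.Term β)
    (g : L.Functions l) (us : Fin l → L.Term β) (h : ∀ i, ∃ j, ts i = us j) :
    height (.func f ts) ≤ height (.func g us) := by
  refine Nat.succ_le_succ (Finset.sup_le fun i _ => ?_)
  obtain ⟨j, hj⟩ := h i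
  rw [hj]
  exact Finset.le_sup (f := fun i => height (us i)) (Finset.mem_univ j)

theorem IsSubterm.refl {β : Type*} (t : L.Term β) : IsSubterm t t := by
  cases t with
  | var => rfl
  | func f ts => exact Or.inl rfl

theorem IsSubterm.height_le {β : Type*} {s t : L.Term β} (h : IsSubterm s t) :
    height s ≤ height t := by
  induction t with
  | var => rw [show s = _ from h]
  | func f ts ih =>
    rcases h with rfl | ⟨i, h⟩
    · exact le_rfl
    · exact (ih i h).trans (height_lt_func f ts i).le

theorem Term.relabel_injective {α β : Type*} {r : α → β} (hr : Function.Injective r) :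
    Function.Injective (Term.relabel r : L.Term α → L.Term β) := by
  intro s t h
  induction s generalizing t with
  | var x =>
    cases t with
    | var y => simp only [Term.relabel, Term.var.injEq] at h; rw [hr h]
    | func => simp [Term.relabel] at h
  | func f ts ih =>
    cases t with
    | var y => simp [Term.relabel] at h
    | func g us =>
      simp only [Term.relabel, Term.func.injEq] at h
      obtain ⟨rfl, h, h'⟩ := h
      cases eq_of_heq h
      have h' := eq_of_heq h'
      congr 1
      funext i
      exact ih i (congrFun h' i)

theorem IsSubterm.of_relabel {α β : Type*} {r : α → β} (hr : Function.Injective r)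
    {s t : L.Term α} (h : IsSubterm (s.relabel r) (t.relabel r)) : IsSubterm s t := by
  induction t with
  | var x => exact Term.relabel_injective hr h
  | func f ts ih =>
    rcases h with h | ⟨i, h⟩
    · exact Or.inl (Term.relabel_injective hr h)
    · exact Or.inr ⟨i, ih i h⟩

/-! ### Substitution -/

theorem liftSubst_comp {n m l : ℕ} (f : V ⊕ Fin n → L.Term (W ⊕ Fin m))
    (g : W ⊕ Fin m → L.Term (X ⊕ Fin l)) :
    (fun x => (liftSubst f x).subst (liftSubst g)) = liftSubst (fun x => (f x).subst g) := by
  have key : ∀ t : L.Term (W ⊕ Fin m), (t.relabel (Sum.map id Fin.castSucc)).subst (liftSubst g) =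
      (t.subst g).relabel (Sum.map id Fin.castSucc) := by
    intro t
    rw [Term.subst_relabel, Term.relabel_subst]
    congr 1
    funext x
    rcases x with x | i <;> simp [liftSubst]
  funext x
  rcases x with x | i
  · simp only [liftSubst, Sum.elim_inl]
    exact key _
  · refine Fin.lastCases ?_ (fun i => ?_) i
    · simp [liftSubst, Term.subst]
    · simp only [liftSubst, Sum.elim_inr, Fin.lastCases_castSucc]
      exact key _

theorem Fml.subst_subst {n : ℕ} (A : Fml L V n) {m l : ℕ} (f : V ⊕ Fin n → L.Term (W ⊕ Fin m))
    (g : W ⊕ Fin m → L.Term (X ⊕ Fin l)) :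
    (A.subst f).subst g = A.subst (fun x => (f x).subst g) := by
  induction A generalizing m l with
  | rel R ts => simp only [Fml.subst, Term.subst_subst]
  | neg A ih => simp only [Fml.subst, ih]
  | and A B ihA ihB => simp only [Fml.subst, ihA, ihB]
  | or A B ihA ihB => simp only [Fml.subst, ihA, ihB]
  | imp A B ihA ihB => simp only [Fml.subst, ihA, ihB]
  | all A ih => simp only [Fml.subst, ih, liftSubst_comp]
  | ex A ih => simp only [Fml.subst, ih, liftSubst_comp]

/-- The substitution that underlies `Fml.ground`. -/
def groundSubst (σ : V → L.Term Empty) (n : ℕ) : V ⊕ Fin n → L.Term (Empty ⊕ Fin n) :=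
  Sum.elim (fun v => (σ v).relabel Sum.inl) (fun i => Term.var (Sum.inr i))

theorem liftSubst_groundSubst (σ : V → L.Term Empty) (n : ℕ) :
    liftSubst (groundSubst σ n) = groundSubst σ (n + 1) := by
  funext x
  rcases x with x | i
  · simp only [liftSubst, groundSubst, Sum.elim_inl, Term.relabel_relabel]
    congr 1
  · refine Fin.lastCases ?_ (fun i => ?_) i <;> simp [liftSubst, groundSubst, Term.relabel]

section ground

variable (σ : V → L.Term Empty)

theorem Fml.ground_neg {n : ℕ} (A : Fml L V n) : (Fml.neg A).ground σ = .neg (A.ground σ) := rfl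

theorem Fml.ground_all {n : ℕ} (A : Fml L V (n + 1)) :
    (Fml.all A).ground σ = .all (A.ground σ) :=
  congrArg Fml.all (congrArg (A.subst ·) (liftSubst_groundSubst σ n))

theorem Fml.ground_ex {n : ℕ} (A : Fml L V (n + 1)) :
    (Fml.ex A).ground σ = .ex (A.ground σ) :=
  congrArg Fml.ex (congrArg (A.subst ·) (liftSubst_groundSubst σ n))

theorem Fml.ground_inst (D : Fml L V 1) (t : L.Term V) :
    (D.inst t).ground σ = (D.ground σ).inst (t.subst σ) := by
  rw [Fml.inst, Fml.inst, Fml.ground, Fml.ground, Fml.subst_subst, Fml.subst_subst]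
  congr 1
  funext x
  rcases x with x | i
  · simp only [Sum.elim_inl, Term.subst, Term.subst_relabel]
    generalize σ x = s
    induction s with
    | var x => exact x.elim
    | func f ts ih => simp only [Term.relabel, Term.subst, ih]
  · simp only [Sum.elim_inr, Term.subst, Term.subst_relabel, Term.relabel_subst]
    rfl

theorem Alpha.ground {A : Fml L V 0} {As : Multiset (Fml L V 0)} (h : Alpha A As) :
    Alpha (A.ground σ) (As.map (Fml.ground σ)) := by
  cases h <;> simp only [Multiset.insert_eq_cons, Multiset.map_cons, Multiset.map_singleton] <;>
    constructor

theorem Beta.ground {A B C : Fml L V 0} (h : Beta A B C) :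
    Beta (A.ground σ) (B.ground σ) (C.ground σ) := by
  cases h <;> constructor

theorem Gamma.ground {A : Fml L V 0} {D : Fml L V 1} (h : Gamma A D) :
    Gamma (A.ground σ) (D.ground σ) := by
  cases h <;> simp only [Fml.ground_neg, Fml.ground_all, Fml.ground_ex] <;> constructor

theorem Delta.ground {A : Fml L V 0} {D : Fml L V 1} (h : Delta A D) :
    Delta (A.ground σ) (D.ground σ) := by
  cases h <;> simp only [Fml.ground_neg, Fml.ground_all, Fml.ground_ex] <;> constructor

end ground

/-! ### Occurrences -/

theorem Fml.SomeArg.mono {p q : ∀ k : ℕ, L.Term (V ⊕ Fin k) → Prop} (h : ∀ k u, p k u → q k u)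
    {n : ℕ} {A : Fml L V n} (hA : A.SomeArg p) : A.SomeArg q := by
  induction A with
  | rel R ts => exact hA.imp fun i hi => h _ _ hi
  | neg A ih => exact ih hA
  | and A B ihA ihB => exact hA.imp ihA ihB
  | or A B ihA ihB => exact hA.imp ihA ihB
  | imp A B ihA ihB => exact hA.imp ihA ihB
  | all A ih => exact ih hA
  | ex A ih => exact ih hA

theorem Fml.HasTerm.hasFun {n k : ℕ} {A : Fml L V n} {f : L.Functions k} {ts : Fin k → L.Term V}
    (h : A.HasTerm (.func f ts)) : A.HasFun f :=
  h.mono fun _ _ hu => ⟨_, hu⟩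

/-- An occurrence of a variable in a substitution instance of a term comes from a variable of the
term. -/
theorem IsSubterm.var_of_subst {β γ : Type*} {x : γ} {t : L.Term β} {s : β → L.Term γ}
    (h : IsSubterm (.var x) (t.subst s)) :
    ∃ y, IsSubterm (.var y) t ∧ IsSubterm (.var x) (s y) := by
  induction t with
  | var y => exact ⟨y, rfl, h⟩
  | func f ts ih =>
    rcases h with h | ⟨i, h⟩
    · cases h
    · obtain ⟨y, hy, hx⟩ := ih i h
      exact ⟨y, Or.inr ⟨i, hy⟩, hx⟩

theorem IsSubterm.var_of_relabel {β γ : Type*} {x : γ} {t : L.Term β} {r : β → γ}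
    (h : IsSubterm (.var x) (t.relabel r)) : ∃ y, IsSubterm (.var y) t ∧ x = r y := by
  induction t with
  | var y => exact ⟨y, rfl, Term.var.inj h⟩
  | func f ts ih =>
    rcases h with h | ⟨i, h⟩
    · cases h
    · obtain ⟨y, hy, hx⟩ := ih i h
      exact ⟨y, Or.inr ⟨i, hy⟩, hx⟩

theorem Fml.hasTerm_var_of_subst {n : ℕ} {A : Fml L V n} {x : V} {m : ℕ}
    {f : V ⊕ Fin n → L.Term (V ⊕ Fin m)} {P : Prop}
    (hv : ∀ v, IsSubterm (.var (Sum.inl x)) (f (.inl v)) → v = x)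
    (hi : ∀ i, IsSubterm (.var (Sum.inl x)) (f (.inr i)) → P)
    (h : (A.subst f).HasTerm (.var x)) : A.HasTerm (.var x) ∨ P := by
  have lift : ∀ {n m : ℕ} {f : V ⊕ Fin n → L.Term (V ⊕ Fin m)},
      (∀ v, IsSubterm (.var (Sum.inl x)) (f (.inl v)) → v = x) →
      (∀ i, IsSubterm (.var (Sum.inl x)) (f (.inr i)) → P) →
      (∀ v, IsSubterm (.var (Sum.inl x)) (liftSubst f (.inl v)) → v = x) ∧
      (∀ i, IsSubterm (.var (Sum.inl x)) (liftSubst f (.inr i)) → P) := by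
    intro n m f hv hi
    have key : ∀ t : L.Term (V ⊕ Fin m),
        IsSubterm (.var (Sum.inl x)) (t.relabel (Sum.map id Fin.castSucc)) →
        IsSubterm (.var (Sum.inl x)) t := by
      intro t ht
      obtain ⟨y, hy, hxy⟩ := ht.var_of_relabel
      rcases y with y | i
      · cases hxy; exact hy
      · cases hxy
    refine ⟨fun v h => hv v (key _ h), fun i => ?_⟩
    refine Fin.lastCases ?_ (fun i => ?_) i
    · simp [liftSubst, IsSubterm]
    · simp only [liftSubst, Sum.elim_inr, Fin.lastCases_castSucc]
      exact fun h => hi i (key _ h)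
  induction A generalizing m with
  | rel R ts =>
    obtain ⟨i, h⟩ := h
    obtain ⟨y, hy, hxy⟩ := IsSubterm.var_of_subst h
    rcases y with y | j
    · rw [hv _ hxy] at hy
      exact Or.inl ⟨i, hy⟩
    · exact Or.inr (hi _ hxy)
  | neg A ih => exact ih hv hi h
  | and A B ihA ihB =>
    rcases h with h | h
    · exact (ihA hv hi h).imp_left Or.inl
    · exact (ihB hv hi h).imp_left Or.inr
  | or A B ihA ihB =>
    rcases h with h | h
    · exact (ihA hv hi h).imp_left Or.inl
    · exact (ihB hv hi h).imp_left Or.inr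
  | imp A B ihA ihB =>
    rcases h with h | h
    · exact (ihA hv hi h).imp_left Or.inl
    · exact (ihB hv hi h).imp_left Or.inr
  | all A ih => exact ih (lift hv hi).1 (lift hv hi).2 h
  | ex A ih => exact ih (lift hv hi).1 (lift hv hi).2 h

theorem Fml.freeVars_inst {D : Fml L V 1} {t : L.Term V} {x : V} (h : x ∈ (D.inst t).freeVars) :
    x ∈ D.freeVars ∨ IsSubterm (.var x) t := by
  refine Fml.hasTerm_var_of_subst (fun v hv => ?_) (fun i hi => ?_) h
  · cases hv; rfl
  · exact IsSubterm.of_relabel (s := .var x) Sum.inl_injective hi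

/-! ### Formulas with standard Skolem terms -/

section IsStd

variable (N : ∀ k, L.Functions k → Prop) (K : ∀ k, L.Functions k → (Fin k → V) → Prop)

/-- Each function symbol of the term satisfies `N`, or is applied to a sequence of free variables
that `K` admits. -/
def IsStdTerm {n : ℕ} : L.Term (V ⊕ Fin n) → Prop
  | .var _ => True
  | .func (l := k) g ts => (N k g ∨ ∃ args, K k g args ∧ ts = fun i => .var (.inl (args i))) ∧
      ∀ i, IsStdTerm (ts i)

/-- All terms of the formula are standard in the sense of `IsStdTerm`. -/
def Fml.IsStd : {n : ℕ} → Fml L V n → Prop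
  | _, .rel _ ts => ∀ i, IsStdTerm N K (ts i)
  | _, .neg A => A.IsStd
  | _, .and A B => A.IsStd ∧ B.IsStd
  | _, .or A B => A.IsStd ∧ B.IsStd
  | _, .imp A B => A.IsStd ∧ B.IsStd
  | _, .all A => A.IsStd
  | _, .ex A => A.IsStd

variable {N K}

theorem IsStdTerm.mono {K' : ∀ k, L.Functions k → (Fin k → V) → Prop}
    (hK : ∀ k g a, K k g a → K' k g a) {n : ℕ} {t : L.Term (V ⊕ Fin n)} (h : IsStdTerm N K t) :
    IsStdTerm N K' t := by
  induction t with
  | var => trivial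
  | func g ts ih => exact ⟨h.1.imp_right fun ⟨a, ha, e⟩ => ⟨a, hK _ _ _ ha, e⟩, fun i => ih i (h.2 i)⟩

theorem Fml.IsStd.mono {K' : ∀ k, L.Functions k → (Fin k → V) → Prop}
    (hK : ∀ k g a, K k g a → K' k g a) {n : ℕ} {A : Fml L V n} (h : A.IsStd N K) :
    A.IsStd N K' := by
  induction A with
  | rel R ts => exact fun i => (h i).mono hK
  | neg A ih => exact ih h
  | and A B ihA ihB => exact h.imp ihA ihB
  | or A B ihA ihB => exact h.imp ihA ihB
  | imp A B ihA ihB => exact h.imp ihA ihB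
  | all A ih => exact ih h
  | ex A ih => exact ih h

theorem IsStdTerm.of_isSubterm {n : ℕ} {t : L.Term (V ⊕ Fin n)}
    (h : ∀ k (g : L.Functions k) ts, IsSubterm (.func g ts) t → N k g) : IsStdTerm N K t := by
  induction t with
  | var => trivial
  | func g ts ih =>
    exact ⟨Or.inl (h _ g ts (IsSubterm.refl _)), fun i => ih i fun k g' ts' h' =>
      h k g' ts' (Or.inr ⟨i, h'⟩)⟩

theorem Fml.IsStd.of_hasFun {n : ℕ} {A : Fml L V n}
    (h : ∀ k (g : L.Functions k), A.HasFun g → N k g) : A.IsStd N K := by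
  induction A with
  | rel R ts => exact fun i => .of_isSubterm fun k g us hu => h k g ⟨i, us, hu⟩
  | neg A ih => exact ih h
  | and A B ihA ihB => exact ⟨ihA fun k g hg => h k g (Or.inl hg), ihB fun k g hg => h k g (Or.inr hg)⟩
  | or A B ihA ihB => exact ⟨ihA fun k g hg => h k g (Or.inl hg), ihB fun k g hg => h k g (Or.inr hg)⟩
  | imp A B ihA ihB => exact ⟨ihA fun k g hg => h k g (Or.inl hg), ihB fun k g hg => h k g (Or.inr hg)⟩
  | all A ih => exact ih h
  | ex A ih => exact ih h

theorem IsStdTerm.relabel {n m : ℕ} {t : L.Term (V ⊕ Fin n)} (h : IsStdTerm N K t)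
    (r : Fin n → Fin m) : IsStdTerm N K (t.relabel (Sum.map id r)) := by
  induction t with
  | var => trivial
  | func g ts ih =>
    refine ⟨h.1.imp_right ?_, fun i => ih i (h.2 i)⟩
    rintro ⟨a, ha, rfl⟩
    exact ⟨a, ha, rfl⟩

theorem IsStdTerm.subst {n m : ℕ} {t : L.Term (V ⊕ Fin n)} (h : IsStdTerm N K t)
    {f : V ⊕ Fin n → L.Term (V ⊕ Fin m)} (hv : ∀ v, f (.inl v) = .var (.inl v))
    (hi : ∀ i, IsStdTerm N K (f (.inr i))) : IsStdTerm N K (t.subst f) := by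
  induction t with
  | var x =>
    rcases x with x | i
    · simp only [Term.subst, hv]; trivial
    · exact hi i
  | func g ts ih =>
    refine ⟨h.1.imp_right ?_, fun i => ih i (h.2 i)⟩
    rintro ⟨a, ha, rfl⟩
    exact ⟨a, ha, by simp only [Term.subst, hv]⟩

theorem Fml.IsStd.subst {n m : ℕ} {A : Fml L V n} (h : A.IsStd N K)
    {f : V ⊕ Fin n → L.Term (V ⊕ Fin m)} (hv : ∀ v, f (.inl v) = .var (.inl v))
    (hi : ∀ i, IsStdTerm N K (f (.inr i))) : (A.subst f).IsStd N K := by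
  have lift : ∀ {n m : ℕ} {f : V ⊕ Fin n → L.Term (V ⊕ Fin m)},
      (∀ v, f (.inl v) = .var (.inl v)) → (∀ i, IsStdTerm N K (f (.inr i))) →
      (∀ v, liftSubst f (.inl v) = .var (.inl v)) ∧
        ∀ i, IsStdTerm N K (liftSubst f (.inr i)) := by
    intro n m f hv hi
    refine ⟨fun v => by simp [liftSubst, hv, Term.relabel], fun i => ?_⟩
    refine Fin.lastCases ?_ (fun i => ?_) i
    · simp [liftSubst, IsStdTerm]
    · simp only [liftSubst, Sum.elim_inr, Fin.lastCases_castSucc]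
      exact (hi i).relabel _
  induction A generalizing m with
  | rel R ts => exact fun i => (h i).subst hv hi
  | neg A ih => exact ih h hv hi
  | and A B ihA ihB => exact ⟨ihA h.1 hv hi, ihB h.2 hv hi⟩
  | or A B ihA ihB => exact ⟨ihA h.1 hv hi, ihB h.2 hv hi⟩
  | imp A B ihA ihB => exact ⟨ihA h.1 hv hi, ihB h.2 hv hi⟩
  | all A ih => exact ih h (lift hv hi).1 (lift hv hi).2
  | ex A ih => exact ih h (lift hv hi).1 (lift hv hi).2

theorem Fml.IsStd.inst {D : Fml L V 1} (h : D.IsStd N K) {t : L.Term V}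
    (ht : IsStdTerm (n := 0) N K (t.relabel Sum.inl)) : (D.inst t).IsStd N K :=
  h.subst (fun _ => rfl) (fun _ => ht)

/-- A Skolem term that occurs in a ground instance of a formula with standard Skolem terms occurs
in the value of a free variable, or is an instance of a standard Skolem term of the formula. -/
theorem IsStdTerm.isSubterm_subst (σ : V → L.Term Empty) {k : ℕ} {f : L.Functions k}
    (hf : ¬ N k f) {ts : Fin k → L.Term Empty} {n : ℕ} {t : L.Term (V ⊕ Fin n)}
    (hs : IsStdTerm N K t)
    (h : IsSubterm ((Term.func f ts).relabel Sum.inl) (t.subst (groundSubst σ n))) :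
    (∃ v, IsSubterm (.var (.inl v)) t ∧ IsSubterm (.func f ts) (σ v)) ∨
      ∃ args, K k f args ∧ ts = (fun i => σ (args i)) ∧
        ∀ i, IsSubterm (.var (.inl (args i))) t := by
  induction t with
  | var x =>
    rcases x with x | i
    · exact Or.inl ⟨x, rfl, IsSubterm.of_relabel Sum.inl_injective h⟩
    · cases h
  | func g us ih =>
    rcases h with h | ⟨i, h⟩
    · simp only [Term.relabel, Term.func.injEq] at h
      obtain ⟨rfl, h, h'⟩ := h
      cases eq_of_heq h
      have h' := eq_of_heq h'
      rcases hs.1 with hN | ⟨args, ha, rfl⟩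
      · exact (hf hN).elim
      · refine Or.inr ⟨args, ha, ?_, fun i => Or.inr ⟨i, rfl⟩⟩
        funext i
        exact Term.relabel_injective Sum.inl_injective (congrFun h' i)
    · rcases ih i (hs.2 i) h with ⟨v, hv, hc⟩ | ⟨args, ha, e, hv⟩
      · exact Or.inl ⟨v, Or.inr ⟨i, hv⟩, hc⟩
      · exact Or.inr ⟨args, ha, e, fun j => Or.inr ⟨i, hv j⟩⟩

theorem Fml.IsStd.hasTerm_ground (σ : V → L.Term Empty) {k : ℕ} {f : L.Functions k}
    (hf : ¬ N k f) {ts : Fin k → L.Term Empty} {n : ℕ} {A : Fml L V n}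
    (hs : A.IsStd N K) (h : (A.ground σ).HasTerm (.func f ts)) :
    (∃ v ∈ A.freeVars, IsSubterm (.func f ts) (σ v)) ∨
      ∃ args, K k f args ∧ ts = (fun i => σ (args i)) ∧ ∀ i, args i ∈ A.freeVars := by
  have weaken : ∀ {n m : ℕ} {B : Fml L V m} {A : Fml L V n}, (∀ v, v ∈ B.freeVars → v ∈ A.freeVars) →
      ((∃ v ∈ B.freeVars, IsSubterm (.func f ts) (σ v)) ∨
        ∃ args, K k f args ∧ ts = (fun i => σ (args i)) ∧ ∀ i, args i ∈ B.freeVars) →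
      ((∃ v ∈ A.freeVars, IsSubterm (.func f ts) (σ v)) ∨
        ∃ args, K k f args ∧ ts = (fun i => σ (args i)) ∧ ∀ i, args i ∈ A.freeVars) := by
    rintro n m B A hBA (⟨v, hv, h⟩ | ⟨args, ha, e, hv⟩)
    · exact Or.inl ⟨v, hBA v hv, h⟩
    · exact Or.inr ⟨args, ha, e, fun i => hBA _ (hv i)⟩
  induction A with
  | rel R us =>
    obtain ⟨i, h⟩ := h
    rcases IsStdTerm.isSubterm_subst σ hf (hs i) h with ⟨v, hv, hc⟩ | ⟨args, ha, e, hv⟩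
    · exact Or.inl ⟨v, ⟨i, hv⟩, hc⟩
    · exact Or.inr ⟨args, ha, e, fun j => ⟨i, hv j⟩⟩
  | neg A ih => exact ih hs h
  | and A B ihA ihB =>
    rcases h with h | h
    · exact weaken (fun _ => Or.inl) (ihA hs.1 h)
    · exact weaken (fun _ => Or.inr) (ihB hs.2 h)
  | or A B ihA ihB =>
    rcases h with h | h
    · exact weaken (fun _ => Or.inl) (ihA hs.1 h)
    · exact weaken (fun _ => Or.inr) (ihB hs.2 h)
  | imp A B ihA ihB =>
    rcases h with h | h
    · exact weaken (fun _ => Or.inl) (ihA hs.1 h)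
    · exact weaken (fun _ => Or.inr) (ihB hs.2 h)
  | all A ih =>
    rw [Fml.ground_all] at h
    exact ih hs h
  | ex A ih =>
    rw [Fml.ground_ex] at h
    exact ih hs h

theorem Alpha.isStd {A : Fml L V 0} {As : Multiset (Fml L V 0)} (h : Alpha A As)
    (hA : A.IsStd N K) {B : Fml L V 0} (hB : B ∈ As) : B.IsStd N K := by
  cases h <;> simp only [Multiset.insert_eq_cons, Multiset.mem_cons, Multiset.mem_singleton] at hB
  case and => rcases hB with rfl | rfl; exacts [hA.1, hA.2]
  case negOr => rcases hB with rfl | rfl; exacts [hA.1, hA.2]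
  case negImp => rcases hB with rfl | rfl; exacts [hA.1, hA.2]
  case negNeg => subst hB; exact hA

theorem Beta.isStd {A B C : Fml L V 0} (h : Beta A B C) (hA : A.IsStd N K) :
    B.IsStd N K ∧ C.IsStd N K := by
  cases h <;> exact hA

theorem Gamma.isStd {A : Fml L V 0} {D : Fml L V 1} (h : Gamma A D) (hA : A.IsStd N K) :
    D.IsStd N K := by
  cases h <;> exact hA

theorem Delta.isStd {A : Fml L V 0} {D : Fml L V 1} (h : Delta A D) (hA : A.IsStd N K) :
    D.IsStd N K := by
  cases h <;> exact hA

theorem Delta.freeVars_eq {A : Fml L V 0} {D : Fml L V 1} (h : Delta A D) :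
    A.freeVars = D.freeVars := by
  cases h <;> rfl

end IsStd

namespace DTree

variable {S R : Type*}

/-! ### Subtrees -/

/-- The subtree at a position. -/
def sub : DTree S R → Pos → Option (DTree S R)
  | t, [] => some t
  | node1 _ _ t, false :: p => t.sub p
  | node2 _ _ t _, false :: p => t.sub p
  | node2 _ _ _ u, true :: p => u.sub p
  | _, _ :: _ => none

theorem sub_nil (t : DTree S R) : t.sub [] = some t := by cases t <;> rfl

theorem sub_append {t t' : DTree S R} {p : Pos} (h : t.sub p = some t') (q : Pos) :
    t.sub (p ++ q) = t'.sub q := by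
  induction p generalizing t with
  | nil => rw [sub_nil] at h; cases h; rfl
  | cons i p ih => cases t <;> cases i <;> first | cases h | exact ih h

theorem ruleAt_append {t t' : DTree S R} {p : Pos} (h : t.sub p = some t') (q : Pos) :
    t.ruleAt (p ++ q) = t'.ruleAt q := by
  induction p generalizing t with
  | nil => rw [sub_nil] at h; cases h; rfl
  | cons i p ih => cases t <;> cases i <;> first | cases h | exact ih h

theorem ruleAt_eq {t t' : DTree S R} {p : Pos} (h : t.sub p = some t') :
    t.ruleAt p = t'.ruleAt [] := by
  have := ruleAt_append h []
  rwa [List.append_nil] at this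

theorem exists_sub_of_ruleAt {t : DTree S R} {p : Pos} {r : R} (h : t.ruleAt p = some r) :
    ∃ t', t.sub p = some t' := by
  induction p generalizing t with
  | nil => exact ⟨t, sub_nil t⟩
  | cons i p ih => cases t <;> cases i <;> first | cases h | exact ih h

theorem Closed.sub {t t' : DTree S R} (ht : t.Closed) {p : Pos} (h : t.sub p = some t') :
    t'.Closed := by
  induction p generalizing t with
  | nil => rw [sub_nil] at h; cases h; exact ht
  | cons i p ih =>
    cases t with
    | leaf => simp [DTree.sub] at h
    | node0 => simp [DTree.sub] at h
    | node1 s r t =>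
      cases i with
      | true => simp [DTree.sub] at h
      | false => exact ih (t := t) ht h
    | node2 s r t u =>
      cases i with
      | true => exact ih ht.2 h
      | false => exact ih ht.1 h

theorem Valid.sub {step : R → S → List S → Prop} {t t' : DTree S R} (ht : t.Valid step) {p : Pos}
    (h : t.sub p = some t') : t'.Valid step := by
  induction p generalizing t with
  | nil => rw [sub_nil] at h; cases h; exact ht
  | cons i p ih =>
    cases t <;> cases i <;> first | cases h | skip
    · exact ih ht.2 h
    · exact ih ht.2.1 h
    · exact ih ht.2.2 h

/-- Induction along a branch: a property of positions and labels that holds at the root and is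
inherited by premises holds at all nodes. -/
theorem Valid.sub_induction {step : R → S → List S → Prop} {t : DTree S R} (ht : t.Valid step)
    {Q : Pos → S → Prop} (h0 : Q [] t.root)
    (h1 : ∀ p s r ps, t.ruleAt p = some r → step r s ps → Q p s →
      ∀ i, ∀ s' ∈ ps, Q (p ++ [i]) s')
    {p : Pos} {t' : DTree S R} (h : t.sub p = some t') : Q p t'.root := by
  induction p generalizing t Q with
  | nil => rw [sub_nil] at h; cases h; exact h0
  | cons i p ih =>
    cases t with
    | leaf => simp [DTree.sub] at h
    | node0 => simp [DTree.sub] at h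
    | node1 s r t =>
      cases i with
      | true => simp [DTree.sub] at h
      | false =>
        exact ih ht.2 (Q := fun p => Q (false :: p)) (h1 [] s r _ rfl ht.1 h0 _ _ (by simp))
          (fun p => h1 (false :: p)) h
    | node2 s r t u =>
      cases i with
      | true =>
        exact ih ht.2.2 (Q := fun p => Q (true :: p)) (h1 [] s r _ rfl ht.1 h0 _ _ (by simp))
          (fun p => h1 (true :: p)) h
      | false =>
        exact ih ht.2.1 (Q := fun p => Q (false :: p)) (h1 [] s r _ rfl ht.1 h0 _ _ (by simp))
          (fun p => h1 (false :: p)) h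

theorem ruleAt_mem_rules {t : DTree S R} {p : Pos} {r : R} (h : t.ruleAt p = some r) :
    r ∈ t.rules := by
  induction t generalizing p with
  | leaf => cases p <;> cases h
  | node0 => cases p <;> cases h; simp [rules]
  | node1 s r' t ih =>
    rcases p with _ | ⟨_ | _, p⟩
    · cases h; simp [rules]
    · exact List.mem_cons_of_mem _ (ih h)
    · cases h
  | node2 s r' t u iht ihu =>
    rcases p with _ | ⟨_ | _, p⟩
    · cases h; simp [rules]
    · exact List.mem_cons_of_mem _ (List.mem_append_left _ (iht h))
    · exact List.mem_cons_of_mem _ (List.mem_append_right _ (ihu h))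

theorem ruleAt_inj {α : Type*} {g : R → Option α} {t : DTree S R}
    (hn : (t.rules.filterMap g).Nodup) {p q : Pos} {r r' : R} {a : α} (hp : t.ruleAt p = some r)
    (hq : t.ruleAt q = some r') (hr : g r = some a) (hr' : g r' = some a) : p = q := by
  have mem : ∀ {t : DTree S R} {p : Pos} {r : R}, t.ruleAt p = some r → g r = some a →
      a ∈ t.rules.filterMap g := fun h h' => List.mem_filterMap.2 ⟨_, ruleAt_mem_rules h, h'⟩
  induction t generalizing p q with
  | leaf => cases p <;> cases hp
  | node0 =>
    cases p <;> cases hp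
    cases q <;> cases hq
    rfl
  | node1 s r₀ t ih =>
    have hn' : (t.rules.filterMap g).Nodup :=
      hn.sublist ((List.sublist_cons_self _ _).filterMap g)
    have hroot : g r₀ = some a → a ∉ t.rules.filterMap g := by
      intro h
      rw [rules, List.filterMap_cons_some h] at hn
      exact (List.nodup_cons.1 hn).1
    rcases p with _ | ⟨_ | _, p⟩ <;> rcases q with _ | ⟨_ | _, q⟩
    · rfl
    · cases hp; exact (hroot hr (mem hq hr')).elim
    · cases hq
    · cases hq; exact (hroot hr' (mem hp hr)).elim
    · rw [ih hn' hp hq]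
    · cases hq
    all_goals cases hp
  | node2 s r₀ t u iht ihu =>
    have hn' : ((t.rules ++ u.rules).filterMap g).Nodup :=
      hn.sublist ((List.sublist_cons_self _ _).filterMap g)
    rw [List.filterMap_append, List.nodup_append'] at hn'
    have hroot : g r₀ = some a → a ∉ t.rules.filterMap g ∧ a ∉ u.rules.filterMap g := by
      intro h
      rw [rules, List.filterMap_cons_some h, List.filterMap_append] at hn
      simpa only [List.mem_append, not_or] using (List.nodup_cons.1 hn).1
    rcases p with _ | ⟨_ | _, p⟩ <;> rcases q with _ | ⟨_ | _, q⟩ <;>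
      first | rfl | skip
    · cases hp; exact ((hroot hr).1 (mem hq hr')).elim
    · cases hp; exact ((hroot hr).2 (mem hq hr')).elim
    · cases hq; exact ((hroot hr').1 (mem hp hr)).elim
    · rw [iht hn'.1 hp hq]
    · exact (hn'.2.2 (mem hp hr) (mem hq hr')).elim
    · cases hq; exact ((hroot hr').2 (mem hp hr)).elim
    · exact (hn'.2.2 (mem hq hr') (mem hp hr)).elim
    · rw [ihu hn'.2.1 hp hq]

theorem exists_finset_ruleAt (t : DTree S R) :
    ∃ P : Finset Pos, ∀ p r, t.ruleAt p = some r → p ∈ P := by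
  classical
  induction t with
  | leaf => exact ⟨∅, fun p r h => by cases p <;> cases h⟩
  | node0 => exact ⟨{[]}, fun p r h => by cases p <;> cases h; simp⟩
  | node1 s r t ih =>
    obtain ⟨P, hP⟩ := ih
    refine ⟨insert [] (P.image (List.cons false)), fun p r h => ?_⟩
    rcases p with _ | ⟨_ | _, p⟩
    · simp
    · simpa using hP _ _ h
    · cases h
  | node2 s r t u iht ihu =>
    obtain ⟨P, hP⟩ := iht
    obtain ⟨P', hP'⟩ := ihu
    refine ⟨insert [] (P.image (List.cons false) ∪ P'.image (List.cons true)), fun p r h => ?_⟩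
    rcases p with _ | ⟨_ | _, p⟩
    · simp
    · simpa using hP _ _ h
    · simpa using hP' _ _ h

/-! ### Leaves, initial parts and extensions -/

theorem leafAt_prefix_inj {t : DTree S R} {p q : Pos} (hp : t.IsLeaf p) (hq : t.IsLeaf q)
    (h : p <+: q) : p = q := by
  obtain ⟨s, hp⟩ := hp
  obtain ⟨s', hq⟩ := hq
  obtain ⟨l, rfl⟩ := h
  induction p generalizing t with
  | nil =>
    cases t <;> cases hp
    cases l <;> first | rfl | cases hq
  | cons i p ih =>
    cases t <;> cases i <;> first | cases hp | exact congrArg _ (ih hp hq)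

theorem Initial.root_eq {t₀ t : DTree S R} (h : t₀.Initial t) : t₀.root = t.root := by
  cases h <;> rfl

theorem Initial.exists_sub {t₀ t : DTree S R} (h : t₀.Initial t) {b : Pos} {s : S}
    (hb : t₀.leafAt b = some s) : ∃ t', t.sub b = some t' ∧ t'.root = s := by
  induction h generalizing b with
  | leaf t =>
    cases b with
    | nil => cases hb; exact ⟨t, sub_nil t, rfl⟩
    | cons => cases hb
  | node0 => cases b <;> cases hb
  | node1 s r h ih => rcases b with _ | ⟨_ | _, b⟩ <;> first | cases hb | exact ih hb
  | node2 s r h k ih ik =>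
    rcases b with _ | ⟨_ | _, b⟩
    · cases hb
    · exact ih hb
    · exact ik hb

theorem root_firstStep (t : DTree S R) : t.firstStep.root = t.root := by cases t <;> rfl

theorem Initial.root_extend {t₀ t : DTree S R} (h : t₀.Initial t) (b : Pos) :
    (t₀.extend t b).root = t₀.root := by
  cases h with
  | leaf =>
    cases b with
    | nil => exact root_firstStep _
    | cons => rfl
  | node0 => rfl
  | node1 => rcases b with _ | ⟨_ | _, b⟩ <;> rfl
  | node2 => rcases b with _ | ⟨_ | _, b⟩ <;> rfl

theorem Initial.leafAt_extend_of_ne {t₀ t : DTree S R} (h : t₀.Initial t) {b p : Pos} (hne : p ≠ b)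
    {s : S} (hp : t₀.leafAt p = some s) : (t₀.extend t b).leafAt p = some s := by
  induction h generalizing b p with
  | leaf t =>
    cases p with
    | cons => cases hp
    | nil =>
      cases b with
      | nil => exact (hne rfl).elim
      | cons => exact hp
  | node0 => cases p <;> cases hp
  | node1 s r h ih =>
    rcases p with _ | ⟨_ | _, p⟩ <;> rcases b with _ | ⟨_ | _, b⟩ <;>
      first | cases hp | exact hp | exact ih (fun e => hne (congrArg _ e)) hp
  | node2 s r h k ih ik =>
    rcases p with _ | ⟨_ | _, p⟩ <;> rcases b with _ | ⟨_ | _, b⟩ <;>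
      first
      | cases hp
      | exact hp
      | exact ih (fun e => hne (congrArg _ e)) hp
      | exact ik (fun e => hne (congrArg _ e)) hp

theorem Initial.leafAt_extend_append {t₀ t t' : DTree S R} (h : t₀.Initial t) {b : Pos}
    (hb : t₀.IsLeaf b) (ht' : t.sub b = some t') (q : Pos) :
    (t₀.extend t b).leafAt (b ++ q) = t'.firstStep.leafAt q := by
  obtain ⟨s, hb⟩ := hb
  induction h generalizing b with
  | leaf t =>
    cases b with
    | nil => rw [sub_nil] at ht'; cases ht'; rfl
    | cons => cases hb
  | node0 => cases b <;> cases hb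
  | node1 s r h ih => rcases b with _ | ⟨_ | _, b⟩ <;> first | cases hb | exact ih ht' hb
  | node2 s r h k ih ik =>
    rcases b with _ | ⟨_ | _, b⟩
    · cases hb
    · exact ih ht' hb
    · exact ik ht' hb

/-! ### Grafting -/

/-- Replace the open leaf with label `s` at each position `p` by the tree `ρ p s`. -/
def graft : DTree S R → (Pos → S → DTree S R) → DTree S R
  | leaf s, ρ => ρ [] s
  | node0 s r, _ => node0 s r
  | node1 s r t, ρ => node1 s r (t.graft fun p => ρ (false :: p))
  | node2 s r t u, ρ => node2 s r (t.graft fun p => ρ (false :: p)) (u.graft fun p => ρ (true :: p))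

theorem initial_graft {t : DTree S R} {ρ : Pos → S → DTree S R}
    (h : ∀ p s, t.leafAt p = some s → (ρ p s).root = s) : t.Initial (t.graft ρ) := by
  induction t generalizing ρ with
  | leaf s =>
    have := Initial.leaf (ρ [] s)
    rwa [h [] s rfl] at this
  | node0 s r => exact .node0 s r
  | node1 s r t ih => exact .node1 s r (ih fun p => h (false :: p))
  | node2 s r t u iht ihu =>
    exact .node2 s r (iht fun p => h (false :: p)) (ihu fun p => h (true :: p))

theorem root_graft {t : DTree S R} {ρ : Pos → S → DTree S R}
    (h : ∀ p s, t.leafAt p = some s → (ρ p s).root = s) : (t.graft ρ).root = t.root :=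
  (initial_graft h).root_eq.symm

theorem Valid.graft {step : R → S → List S → Prop} {t : DTree S R} (ht : t.Valid step)
    {ρ : Pos → S → DTree S R} (h : ∀ p s, t.leafAt p = some s → (ρ p s).root = s)
    (hv : ∀ p s, t.leafAt p = some s → (ρ p s).Valid step) : (t.graft ρ).Valid step := by
  induction t generalizing ρ with
  | leaf s => exact hv [] s rfl
  | node0 s r => exact ht
  | node1 s r t ih =>
    refine ⟨?_, ih ht.2 (fun p => h (false :: p)) (fun p => hv (false :: p))⟩
    rw [root_graft fun p => h (false :: p)]
    exact ht.1
  | node2 s r t u iht ihu =>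
    refine ⟨?_, iht ht.2.1 (fun p => h (false :: p)) (fun p => hv (false :: p)),
      ihu ht.2.2 (fun p => h (true :: p)) (fun p => hv (true :: p))⟩
    rw [root_graft fun p => h (false :: p), root_graft fun p => h (true :: p)]
    exact ht.1

theorem leafAt_graft_append {t : DTree S R} {ρ : Pos → S → DTree S R} {p : Pos} {s : S}
    (h : t.leafAt p = some s) (q : Pos) : (t.graft ρ).leafAt (p ++ q) = (ρ p s).leafAt q := by
  induction t generalizing ρ p with
  | leaf s => cases p <;> cases h; rfl
  | node0 => cases p <;> cases h
  | node1 s r t ih => rcases p with _ | ⟨_ | _, p⟩ <;> first | cases h | exact ih h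
  | node2 s r t u iht ihu =>
    rcases p with _ | ⟨_ | _, p⟩
    · cases h
    · exact iht h
    · exact ihu h

theorem ruleAt_graft {t : DTree S R} {ρ : Pos → S → DTree S R} {p : Pos} {s : S}
    (h : t.leafAt p = some s) : (t.graft ρ).ruleAt p = (ρ p s).ruleAt [] := by
  induction t generalizing ρ p with
  | leaf s => cases p <;> cases h; rfl
  | node0 => cases p <;> cases h
  | node1 s r t ih => rcases p with _ | ⟨_ | _, p⟩ <;> first | cases h | exact ih h
  | node2 s r t u iht ihu =>
    rcases p with _ | ⟨_ | _, p⟩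
    · cases h
    · exact iht h
    · exact ihu h

theorem exists_of_leafAt_graft {t : DTree S R} {ρ : Pos → S → DTree S R} {q : Pos} {s' : S}
    (h : (t.graft ρ).leafAt q = some s') :
    ∃ p s l, t.leafAt p = some s ∧ q = p ++ l ∧ (ρ p s).leafAt l = some s' := by
  induction t generalizing ρ q with
  | leaf s => exact ⟨[], s, q, rfl, rfl, h⟩
  | node0 => cases q <;> cases h
  | node1 s r t ih =>
    rcases q with _ | ⟨_ | _, q⟩
    · cases h
    · obtain ⟨p, s, l, h1, rfl, h2⟩ := ih h
      exact ⟨false :: p, s, l, h1, rfl, h2⟩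
    · cases h
  | node2 s r t u iht ihu =>
    rcases q with _ | ⟨_ | _, q⟩
    · cases h
    · obtain ⟨p, s, l, h1, rfl, h2⟩ := iht h
      exact ⟨false :: p, s, l, h1, rfl, h2⟩
    · obtain ⟨p, s, l, h1, rfl, h2⟩ := ihu h
      exact ⟨true :: p, s, l, h1, rfl, h2⟩

end DTree

/-! ### A termination measure -/

/-- A measure on predicates that decreases when the predicate is extended by an element and only
loses elements with greater keys. -/
theorem exists_measure {ι : Type*} (R : Finset ι) (key : ι → ℕ) :
    ∃ m : (ι → Prop) → ℕ, (∀ E E' : ι → Prop, (∀ q, E q → E' q) → m E' ≤ m E) ∧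
      ∀ (E E' : ι → Prop), ∀ r ∈ R, ¬ E r → E' r → (∀ q, E q → ¬ E' q → key r < key q) →
        m E' < m E := by
  classical
  refine ⟨fun E => ∑ q ∈ R with ¬ E q, (R.card + 1) ^ (R.sup key - key q), ?_, ?_⟩
  · intro E E' h
    exact Finset.sum_le_sum_of_subset (Finset.monotone_filter_right R fun q _ hq => mt (h q) hq)
  · intro E E' r hr hE hE' h
    dsimp only
    have hsub : R.filter (fun q => ¬ E' q) ⊆
        (R.filter fun q => ¬ E q).erase r ∪ R.filter fun q => key r < key q := by
      intro q hq
      rw [Finset.mem_filter] at hq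
      rw [Finset.mem_union, Finset.mem_erase, Finset.mem_filter, Finset.mem_filter]
      by_cases hq' : E q
      · exact Or.inr ⟨hq.1, h q hq' hq.2⟩
      · exact Or.inl ⟨fun e => hq.2 (e ▸ hE'), hq.1, hq'⟩
    have hmem : r ∈ R.filter fun q => ¬ E q := Finset.mem_filter.2 ⟨hr, hE⟩
    rw [← Finset.sum_erase_add _ _ hmem]
    refine (Finset.sum_le_sum_of_subset hsub).trans_lt ?_
    refine (?_ :
      _ ≤ (∑ q ∈ (R.filter fun q => ¬ E q).erase r, (R.card + 1) ^ (R.sup key - key q)) +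
        ∑ q ∈ R.filter fun q => key r < key q, (R.card + 1) ^ (R.sup key - key q)).trans_lt ?_
    · rw [← Finset.sum_union_inter]
      exact Nat.le_add_right _ _
    refine Nat.add_lt_add_left ?_ _
    refine lt_of_mul_lt_mul_left ?_ (Nat.zero_le (R.card + 1))
    calc (R.card + 1) * ∑ q ∈ R with key r < key q, (R.card + 1) ^ (R.sup key - key q)
        = ∑ q ∈ R with key r < key q, (R.card + 1) ^ (R.sup key - key q + 1) := by
          rw [Finset.mul_sum]
          exact Finset.sum_congr rfl fun q _ => (pow_succ' _ _).symm
      _ ≤ ∑ q ∈ R with key r < key q, (R.card + 1) ^ (R.sup key - key r) := by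
          refine Finset.sum_le_sum fun q hq => Nat.pow_le_pow_right (Nat.succ_pos _) ?_
          rw [Finset.mem_filter] at hq
          have := Finset.le_sup (f := key) hq.1
          have := hq.2
          omega
      _ ≤ R.card * (R.card + 1) ^ (R.sup key - key r) := by
          rw [Finset.sum_const, smul_eq_mul]
          exact Nat.mul_le_mul_right _ (Finset.card_filter_le _ _)
      _ < (R.card + 1) * (R.card + 1) ^ (R.sup key - key r) :=
          Nat.mul_lt_mul_of_pos_right (Nat.lt_succ_self _) (Nat.pow_pos (Nat.succ_pos _))

/-! ### Derivations in GS3 -/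

section Derives

variable {Sk : ∀ k, Set (L.Functions k)} {Θ : Multiset (Fml L Empty 0)}

/-- There is a proof tree of the sequent `Δ` all of whose open leaves contain `Θ`, which has an open
leaf if `need` holds, and which is not just an open leaf if `proper` holds. -/
def Derives (Sk : ∀ k, Set (L.Functions k)) (Θ : Multiset (Fml L Empty 0)) (need proper : Prop)
    (Δ : Multiset (Fml L Empty 0)) : Prop :=
  ∃ π : GSTree L, π.root = Δ ∧ IsProofTree Sk π ∧ (∀ q s, π.leafAt q = some s → Θ ⊆ s) ∧
    (need → ∃ q, π.IsLeaf q) ∧ (proper → ¬ π.IsLeaf [])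

variable {need proper : Prop} {Δ : Multiset (Fml L Empty 0)}

theorem Derives.of_subset (h : Θ ⊆ Δ) : Derives Sk Θ need False Δ := by
  refine ⟨.leaf Δ, rfl, trivial, fun q s hq => ?_, fun _ => ⟨[], Δ, rfl⟩, False.elim⟩
  cases q <;> cases hq
  exact h

theorem Derives.step0 {r : GSRule L} (hr : r.Step Sk Δ []) (h : ¬ need) :
    Derives Sk Θ need proper Δ := by
  refine ⟨.node0 Δ r, rfl, hr, fun q s hq => ?_, fun hn => (h hn).elim, ?_⟩
  · cases q <;> cases hq
  · rintro - ⟨s, hs⟩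
    cases hs

theorem Derives.step1 {r : GSRule L} {Δ' : Multiset (Fml L Empty 0)} {proper' : Prop}
    (hr : r.Step Sk Δ [Δ']) (h : Derives Sk Θ need proper' Δ') : Derives Sk Θ need proper Δ := by
  obtain ⟨π, rfl, hv, hl, hn, -⟩ := h
  refine ⟨.node1 Δ r π, rfl, ⟨hr, hv⟩, fun q s hq => ?_, fun h => ?_, ?_⟩
  · rcases q with _ | ⟨_ | _, q⟩ <;> first | cases hq | exact hl q s hq
  · obtain ⟨q, s, hq⟩ := hn h
    exact ⟨false :: q, s, hq⟩
  · rintro - ⟨s, hs⟩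
    cases hs

theorem Derives.step2 {r : GSRule L} {Δ₁ Δ₂ : Multiset (Fml L Empty 0)}
    {need₁ need₂ proper₁ proper₂ : Prop} (hr : r.Step Sk Δ [Δ₁, Δ₂])
    (h₁ : Derives Sk Θ need₁ proper₁ Δ₁) (h₂ : Derives Sk Θ need₂ proper₂ Δ₂)
    (h : need → need₁ ∨ need₂) : Derives Sk Θ need proper Δ := by
  obtain ⟨π₁, rfl, hv₁, hl₁, hn₁, -⟩ := h₁
  obtain ⟨π₂, rfl, hv₂, hl₂, hn₂, -⟩ := h₂
  refine ⟨.node2 Δ r π₁ π₂, rfl, ⟨hr, hv₁, hv₂⟩, fun q s hq => ?_, fun hn => ?_, ?_⟩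
  · rcases q with _ | ⟨_ | _, q⟩
    · cases hq
    · exact hl₁ q s hq
    · exact hl₂ q s hq
  · rcases h hn with h | h
    · obtain ⟨q, s, hq⟩ := hn₁ h
      exact ⟨false :: q, s, hq⟩
    · obtain ⟨q, s, hq⟩ := hn₂ h
      exact ⟨true :: q, s, hq⟩
  · rintro - ⟨s, hs⟩
    cases hs

theorem Derives.weaken (h : Derives Sk Θ need proper Δ) (Δ' : Multiset (Fml L Empty 0)) :
    Derives Sk Θ need proper (Δ' + Δ) := by
  induction Δ' using Multiset.induction_on with
  | empty => rwa [zero_add]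
  | cons A Δ' ih =>
    rw [Multiset.cons_add]
    exact .step1 (r := .weak A) ⟨_, rfl, rfl⟩ ih

theorem Derives.mono {need' proper' : Prop} (h : Derives Sk Θ need proper Δ)
    (hn : need' → need) (hp : proper' → proper) : Derives Sk Θ need' proper' Δ := by
  obtain ⟨π, h1, h2, h3, h4, h5⟩ := h
  exact ⟨π, h1, h2, h3, h4 ∘ hn, h5 ∘ hp⟩

open Classical in
/-- A `δ`-inference with a witness that is made fresh by weakening. -/
theorem Derives.delta {A : Fml L Empty 0} {D : Fml L Empty 1} {c : L.Term Empty}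
    (hD : Delta A D) (hA : A ∈ Δ) (hc : IsWitness Sk c) (hAc : ¬ A.HasTerm c) {proper' : Prop}
    (h : Derives Sk Θ need proper' (D.inst c ::ₘ Δ.filter fun B => ¬ B.HasTerm c)) :
    Derives Sk Θ need proper Δ := by
  rw [← Multiset.filter_add_not (fun B => B.HasTerm c) Δ]
  refine Derives.weaken (.step1 (r := .delta A D c) ⟨hD, ?_, hc, ?_, rfl⟩ h) _
  · exact Multiset.mem_filter.2 ⟨hA, hAc⟩
  · exact fun B hB => (Multiset.mem_filter.1 hB).2

end Derives

/-! ### Direct steps -/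

theorem TabRule.Step.toGS {Sk : ∀ k, Set (L.Functions k)} {σ : V → L.Term Empty} {r : TabRule L V}
    (hr : ¬ r.IsDelta) (hσ : ∀ A B, r = .closure A B → A.ground σ = B.ground σ)
    {Δ : Multiset (Fml L V 0)} {ps : List (Multiset (Fml L V 0))} (h : r.Step Sk Δ ps)
    {Δ' : Multiset (Fml L Empty 0)} (hΔ : Δ.map (Fml.ground σ) ⊆ Δ') :
    ∃ ps', (r.toGS σ).Step Sk Δ' ps' ∧
      List.Forall₂ (fun p p' => p.map (Fml.ground σ) ⊆ p' ∧ Δ' ⊆ p') ps ps' := by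
  have mem : ∀ {A}, A ∈ Δ → A.ground σ ∈ Δ' := fun hA => hΔ (Multiset.mem_map_of_mem _ hA)
  have cons : ∀ A : Fml L V 0, (A ::ₘ Δ).map (Fml.ground σ) ⊆ A.ground σ ::ₘ Δ' ∧
      Δ' ⊆ A.ground σ ::ₘ Δ' := fun A => by
    rw [Multiset.map_cons]
    exact ⟨Multiset.cons_subset_cons hΔ, Multiset.subset_cons _ _⟩
  cases r with
  | closure A B =>
    obtain ⟨hA, hB, rfl⟩ := h
    refine ⟨[], ⟨mem hA, ?_, rfl⟩, .nil⟩
    rw [hσ A B rfl]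
    exact mem hB
  | alpha A As =>
    obtain ⟨hr, hA, rfl⟩ := h
    refine ⟨[As.map (Fml.ground σ) + Δ'], ⟨hr.ground σ, mem hA, rfl⟩, .cons ⟨?_, ?_⟩ .nil⟩
    · rw [Multiset.map_add]
      intro B hB
      rw [Multiset.mem_add] at hB ⊢
      exact hB.imp_right fun h => hΔ h
    · exact Multiset.subset_of_le (Multiset.le_add_left _ _)
  | beta A B C =>
    obtain ⟨hr, hA, rfl⟩ := h
    exact ⟨_, ⟨hr.ground σ, mem hA, rfl⟩, .cons (cons B) (.cons (cons C) .nil)⟩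
  | gamma A D x =>
    obtain ⟨hr, hA, rfl⟩ := h
    refine ⟨_, ⟨hr.ground σ, mem hA, rfl⟩, .cons ?_ .nil⟩
    have := cons (D.inst (.var x))
    rwa [Fml.ground_inst] at this
  | delta A D f args => exact (hr trivial).elim

/-! ### Skolem terms of a closed tableau -/

/-- `f` is introduced, with arguments `a`, strictly below the position `p`. -/
def IntroducedBefore (T : TabTree L V) (p : Pos) (k : ℕ) (f : L.Functions k) (a : Fin k → V) :
    Prop :=
  ∃ q A D, q <+: p ∧ q ≠ p ∧ T.ruleAt q = some (.delta A D f a)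

theorem IntroducedBefore.append {T : TabTree L V} {p : Pos} {k : ℕ} {f : L.Functions k}
    {a : Fin k → V} (h : IntroducedBefore T p k f a) (i : Bool) :
    IntroducedBefore T (p ++ [i]) k f a := by
  obtain ⟨q, A, D, h, hne, hq⟩ := h
  refine ⟨q, A, D, h.trans (List.prefix_append _ _), ?_, hq⟩
  rintro rfl
  have := h.length_le
  simp at this

/-- The symbol `f` occurs in `Γ`. -/
def OccursIn (Γ : Multiset (Fml L V 0)) (k : ℕ) (f : L.Functions k) : Prop := ∃ A ∈ Γ, A.HasFun f

theorem TabRule.Step.subset {Sk : ∀ k, Set (L.Functions k)} {r : TabRule L V}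
    {Δ : Multiset (Fml L V 0)} {ps : List (Multiset (Fml L V 0))} (h : r.Step Sk Δ ps) :
    ∀ p ∈ ps, Δ ⊆ p := by
  cases r with
  | closure A B => obtain ⟨-, -, rfl⟩ := h; simp
  | alpha A As =>
    obtain ⟨-, -, rfl⟩ := h
    simpa using Multiset.subset_of_le (Multiset.le_add_left _ _)
  | beta A B C => obtain ⟨-, -, rfl⟩ := h; simp [Multiset.subset_cons]
  | gamma A D x => obtain ⟨-, -, rfl⟩ := h; simp [Multiset.subset_cons]
  | delta A D f a => obtain ⟨-, -, -, -, -, rfl⟩ := h; simp [Multiset.subset_cons]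

section Tableau

variable {Sk : ∀ k, Set (L.Functions k)} {Γ : Multiset (Fml L V 0)} {T : TabTree L V}

theorem IsTableau.subset_root (hT : IsTableau Sk Γ T) {p : Pos} {T' : TabTree L V}
    (h : T.sub p = some T') : Γ ⊆ T'.root := by
  refine hT.valid.sub_induction (Q := fun _ s => Γ ⊆ s) ?_ ?_ h
  · rw [hT.root_eq]; exact Multiset.Subset.refl _
  · exact fun p s r ps _ hr hs i s' hs' => Multiset.Subset.trans hs (hr.subset s' hs')

theorem IsTableau.isStd (hT : IsTableau Sk Γ T) {p : Pos} {T' : TabTree L V}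
    (h : T.sub p = some T') :
    ∀ A ∈ T'.root, A.IsStd (OccursIn Γ) (IntroducedBefore T p) := by
  refine hT.valid.sub_induction
    (Q := fun p s => ∀ A ∈ s, A.IsStd (OccursIn Γ) (IntroducedBefore T p)) ?_ ?_ h
  · rw [hT.root_eq]
    exact fun A hA => .of_hasFun fun k g hg => ⟨A, hA, hg⟩
  · intro p s r ps hp hr hs i s' hs'
    replace hs : ∀ A ∈ s, A.IsStd (OccursIn Γ) (IntroducedBefore T (p ++ [i])) :=
      fun A hA => (hs A hA).mono fun _ _ _ h => h.append i
    cases r with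
    | closure A B => obtain ⟨-, -, rfl⟩ := hr; simp at hs'
    | alpha A As =>
      obtain ⟨hr, hA, rfl⟩ := hr
      rw [List.mem_singleton] at hs'
      subst hs'
      intro B hB
      rcases Multiset.mem_add.1 hB with hB | hB
      · exact hr.isStd (hs A hA) hB
      · exact hs B hB
    | beta A B C =>
      obtain ⟨hr, hA, rfl⟩ := hr
      simp only [List.mem_cons, List.not_mem_nil, or_false] at hs'
      rcases hs' with rfl | rfl <;> intro F hF <;> rcases Multiset.mem_cons.1 hF with rfl | hF
      · exact (hr.isStd (hs A hA)).1
      · exact hs F hF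
      · exact (hr.isStd (hs A hA)).2
      · exact hs F hF
    | gamma A D x =>
      obtain ⟨hr, hA, rfl⟩ := hr
      rw [List.mem_singleton] at hs'
      subst hs'
      intro F hF
      rcases Multiset.mem_cons.1 hF with rfl | hF
      · exact (hr.isStd (hs A hA)).inst trivial
      · exact hs F hF
    | delta A D f a =>
      obtain ⟨hr, hA, -, -, -, rfl⟩ := hr
      rw [List.mem_singleton] at hs'
      subst hs'
      intro F hF
      rcases Multiset.mem_cons.1 hF with rfl | hF
      · refine (hr.isStd (hs A hA)).inst ⟨Or.inr ⟨a, ?_, rfl⟩, fun _ => trivial⟩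
        exact ⟨p, A, D, List.prefix_append _ _, by simp, hp⟩
      · exact hs F hF

theorem IsTableau.exists_of_ruleAt_delta (hT : IsTableau Sk Γ T) {p : Pos} {A : Fml L V 0}
    {D : Fml L V 1} {k : ℕ} {f : L.Functions k} {a : Fin k → V}
    (hp : T.ruleAt p = some (.delta A D f a)) :
    ∃ s t, T.sub p = some (.node1 s (.delta A D f a) t) ∧
      (TabRule.delta A D f a).Step Sk s [t.root] := by
  obtain ⟨T', hT'⟩ := DTree.exists_sub_of_ruleAt hp
  rw [DTree.ruleAt_eq hT'] at hp
  have hv := hT.valid.sub hT'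
  cases T' with
  | leaf => cases hp
  | node0 s r => cases hp; obtain ⟨-, -, -, -, -, h⟩ := hv; cases h
  | node1 s r t => cases hp; exact ⟨s, t, hT', hv.1⟩
  | node2 s r t u => cases hp; obtain ⟨⟨-, -, -, -, -, h⟩, -⟩ := hv; exact absurd h (by simp)

theorem IsTableau.not_occursIn (hT : IsTableau Sk Γ T) {p : Pos} {A : Fml L V 0}
    {D : Fml L V 1} {k : ℕ} {f : L.Functions k} {a : Fin k → V}
    (hp : T.ruleAt p = some (.delta A D f a)) : ¬ OccursIn Γ k f := by
  rintro ⟨B, hB, h⟩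
  exact hT.newSym_fresh ⟨k, f⟩
    (List.mem_filterMap.2 ⟨_, DTree.ruleAt_mem_rules hp, rfl⟩) B hB h

theorem IsTableau.prefix_of_introducedBefore (hT : IsTableau Sk Γ T) {p q : Pos} {A : Fml L V 0}
    {D : Fml L V 1} {k : ℕ} {f : L.Functions k} {a a' : Fin k → V}
    (hp : T.ruleAt p = some (.delta A D f a)) (h : IntroducedBefore T q k f a') :
    p <+: q ∧ p ≠ q := by
  obtain ⟨p', A', D', h1, h2, hp'⟩ := h
  rw [DTree.ruleAt_inj hT.newSym_nodup hp hp' rfl rfl]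
  exact ⟨h1, h2⟩

/-- The Skolem term of a `δ`-inference does not occur in the instance of its active formula. -/
theorem IsTableau.not_hasTerm_active (hT : IsTableau Sk Γ T) (σ : V → L.Term Empty) {p : Pos}
    {A : Fml L V 0} {D : Fml L V 1} {k : ℕ} {f : L.Functions k} {a : Fin k → V}
    (hp : T.ruleAt p = some (.delta A D f a)) :
    ¬ (A.ground σ).HasTerm (.func f fun i => σ (a i)) := by
  intro h
  obtain ⟨s, t, hs, hD, hA, -, -, ha, -⟩ := hT.exists_of_ruleAt_delta hp
  rcases (hT.isStd hs A hA).hasTerm_ground σ (hT.not_occursIn hp) h with ⟨v, hv, h⟩ | ⟨a', ha', -⟩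
  · rw [hD.freeVars_eq, ← ha] at hv
    obtain ⟨i, rfl⟩ := hv
    exact absurd h.height_le (not_le.2 (height_lt_func f (fun i => σ (a i)) i))
  · exact (hT.prefix_of_introducedBefore hp ha').2 rfl

/-- If the Skolem term of a `δ`-inference occurs in the instance that another `δ`-inference
introduces, then it is smaller, or it is introduced earlier and not higher. -/
theorem IsTableau.lt_of_hasTerm_inst (hT : IsTableau Sk Γ T) (σ : V → L.Term Empty) {p q : Pos}
    {A : Fml L V 0} {D : Fml L V 1} {k : ℕ} {f : L.Functions k} {a : Fin k → V}
    (hp : T.ruleAt p = some (.delta A D f a)) {B : Fml L V 0} {C : Fml L V 1} {l : ℕ}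
    {g : L.Functions l} {c : Fin l → V} (hq : T.ruleAt q = some (.delta B C g c)) (hpq : p ≠ q)
    (h : ((C.inst (.func g fun i => .var (c i))).ground σ).HasTerm (.func f fun i => σ (a i))) :
    height (.func f fun i => σ (a i)) < height (.func g fun i => σ (c i)) ∨
      height (.func f fun i => σ (a i)) ≤ height (.func g fun i => σ (c i)) ∧
        p.length < q.length := by
  obtain ⟨s, t, hs, -, -, -, -, hc, ht⟩ := hT.exists_of_ruleAt_delta hq
  have hstd := hT.isStd ((DTree.sub_append hs [false]).trans (DTree.sub_nil t))
    (C.inst (.func g fun i => .var (c i))) (by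
      rw [List.singleton_inj.1 ht]; exact Multiset.mem_cons_self _ _)
  have hfree : ∀ v ∈ (C.inst (.func g fun i => .var (c i))).freeVars, ∃ i, c i = v := by
    intro v hv
    rcases Fml.freeVars_inst hv with hv | hv
    · rwa [← hc] at hv
    · rcases hv with hv | ⟨i, hv⟩
      · cases hv
      · exact ⟨i, (Term.var.inj hv).symm⟩
  rcases hstd.hasTerm_ground σ (hT.not_occursIn hp) h with ⟨v, hv, h⟩ | ⟨a', ha', e, hv⟩
  · obtain ⟨i, rfl⟩ := hfree v hv
    exact Or.inl (h.height_le.trans_lt (height_lt_func g (fun i => σ (c i)) i))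
  · refine Or.inr ⟨height_func_le _ _ _ _ fun i => ?_, ?_⟩
    · obtain ⟨j, hj⟩ := hfree _ (hv i)
      exact ⟨j, (congrFun e i).trans (congrArg σ hj.symm)⟩
    · obtain ⟨h1, -⟩ := hT.prefix_of_introducedBefore hp ha'
      rcases List.prefix_concat_iff.1 h1 with h1 | h1
      · have hlen := (hT.prefix_of_introducedBefore hp ha').2 h1
        exact hlen.elim
      · exact lt_of_le_of_ne h1.length_le fun e => hpq (h1.eq_of_length e)

/-- The instance introduced by the `δ`-inference at the position `q` belongs to `Δ`. -/
def Established (T : TabTree L V) (σ : V → L.Term Empty) (Δ : Multiset (Fml L Empty 0)) (q : Pos) :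
    Prop :=
  ∃ (A : Fml L V 0) (D : Fml L V 1) (k : ℕ) (f : L.Functions k) (a : Fin k → V),
    T.ruleAt q = some (.delta A D f a) ∧ (D.inst (.func f fun i => .var (a i))).ground σ ∈ Δ

theorem IsTableau.exists_measure (hT : IsTableau Sk Γ T) (σ : V → L.Term Empty) :
    ∃ m : Multiset (Fml L Empty 0) → ℕ, (∀ Δ Δ', Δ ⊆ Δ' → m Δ' ≤ m Δ) ∧
      ∀ (Δ Δ' : Multiset (Fml L Empty 0)) (p : Pos) (A : Fml L V 0) (D : Fml L V 1) (k : ℕ)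
        (f : L.Functions k) (a : Fin k → V), T.ruleAt p = some (.delta A D f a) →
        (D.inst (.func f fun i => .var (a i))).ground σ ∉ Δ →
        (D.inst (.func f fun i => .var (a i))).ground σ ∈ Δ' →
        (∀ B ∈ Δ, ¬ B.HasTerm (.func f fun i => σ (a i)) → B ∈ Δ') → m Δ' < m Δ := by
  obtain ⟨R, hR⟩ := T.exists_finset_ruleAt
  have hlen : ∀ {q r}, T.ruleAt q = some r → q.length < R.sup List.length + 1 := fun h =>
    Nat.lt_succ_of_le (Finset.le_sup (f := List.length) (hR _ _ h))
  let key : Pos → ℕ := fun q =>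
    match T.ruleAt q with
    | some (.delta _ _ f a) =>
      height (.func f fun i => σ (a i)) * (R.sup List.length + 1) + q.length
    | _ => 0
  have hkey : ∀ {q A D k} {f : L.Functions k} {a}, T.ruleAt q = some (.delta A D f a) →
      key q = height (.func f fun i => σ (a i)) * (R.sup List.length + 1) + q.length := by
    intro q A D k f a h
    simp only [key, h]
  obtain ⟨m, hm, hm'⟩ := FVTab.exists_measure R key
  refine ⟨fun Δ => m (Established T σ Δ), fun Δ Δ' h => hm _ _ ?_, ?_⟩
  · rintro q ⟨A, D, k, f, a, hq, hΔ⟩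
    exact ⟨A, D, k, f, a, hq, h hΔ⟩
  · intro Δ Δ' p A D k f a hp hΔ hΔ' h
    refine hm' _ _ p (hR _ _ hp) ?_ ⟨A, D, k, f, a, hp, hΔ'⟩ ?_
    · rintro ⟨A', D', k', f', a', hp', h'⟩
      rw [hp] at hp'
      cases hp'
      exact hΔ h'
    · rintro q ⟨B, C, l, g, c, hq, hC⟩ hn
      have hpq : p ≠ q := by
        rintro rfl
        exact hn ⟨A, D, k, f, a, hp, hΔ'⟩
      have hocc : ((C.inst (.func g fun i => .var (c i))).ground σ).HasTerm
          (.func f fun i => σ (a i)) := by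
        by_contra hno
        exact hn ⟨B, C, l, g, c, hq, h _ hC hno⟩
      rw [hkey hp, hkey hq]
      have h1 := hlen hp
      rcases hT.lt_of_hasTerm_inst σ hp hq hpq hocc with hlt | ⟨hle, hlt⟩
      · have := Nat.mul_le_mul_right (R.sup List.length + 1) (Nat.succ_le_of_lt hlt)
        rw [Nat.succ_mul] at this
        omega
      · have := Nat.mul_le_mul_right (R.sup List.length + 1) hle
        omega

end Tableau

section ClosedTableau

variable {Sk : ∀ k, Set (L.Functions k)} {Γ : Multiset (Fml L V 0)} {T : TabTree L V}
  {σ : V → L.Term Empty}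

open Classical in
/-- The sequent that remains when the Skolem term of a `δ`-inference has been made fresh contains
the instance of the root. -/
theorem IsClosedTableau.root_subset_filter (hT : IsClosedTableau Sk Γ T σ)
    {Δ : Multiset (Fml L Empty 0)} (hΔ : Γ.map (Fml.ground σ) ⊆ Δ) {k : ℕ} {f : L.Functions k}
    (hf : f ∈ Sk k) (ts : Fin k → L.Term Empty) :
    Γ.map (Fml.ground σ) ⊆ Δ.filter fun B => ¬ B.HasTerm (.func f ts) := by
  intro B hB
  refine Multiset.mem_filter.2 ⟨hΔ hB, fun h => ?_⟩
  obtain ⟨A, hA, rfl⟩ := Multiset.mem_map.1 hB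
  exact hT.noSkolem A hA k f hf h.hasFun

open Classical in
/-- Every `δ`-inference of a closed tableau can be performed in GS3, after some weakenings. -/
theorem IsClosedTableau.derives_delta (hT : IsClosedTableau Sk Γ T σ)
    {Θ Δ : Multiset (Fml L Empty 0)} {need proper proper' : Prop} {p : Pos} {A : Fml L V 0}
    {D : Fml L V 1} {k : ℕ} {f : L.Functions k} {a : Fin k → V}
    (hp : T.ruleAt p = some (.delta A D f a)) (hA : A.ground σ ∈ Δ)
    (h : Derives Sk Θ need proper' ((D.inst (.func f fun i => .var (a i))).ground σ ::ₘ
      Δ.filter fun B => ¬ B.HasTerm (.func f fun i => σ (a i)))) :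
    Derives Sk Θ need proper Δ := by
  obtain ⟨s, t, -, hD, -, hf, -⟩ := hT.isTableau.exists_of_ruleAt_delta hp
  rw [Fml.ground_inst] at h
  exact .delta (hD.ground σ) hA ⟨k, f, _, rfl, Or.inr hf⟩
    (hT.isTableau.not_hasTerm_active σ hp) h

/-- Each sequent that contains the instance of the root of a closed tableau `T` has a proof tree
with open leaves, all of which contain the instance of a given node of `T`. -/
theorem IsClosedTableau.derives (hT : IsClosedTableau Sk Γ T σ) {b : Pos} {Tb : TabTree L V}
    (hb : T.sub b = some Tb) {Δ : Multiset (Fml L Empty 0)} (hΔ : Γ.map (Fml.ground σ) ⊆ Δ) :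
    Derives Sk (Tb.root.map (Fml.ground σ)) True False Δ := by
  classical
  obtain ⟨m, hm, hm'⟩ := hT.isTableau.exists_measure σ
  induction hn : m Δ using Nat.strong_induction_on generalizing Δ with
  | _ n IH =>
  subst hn
  have walk : ∀ (T' : TabTree L V) (p : Pos) (Δ' : Multiset (Fml L Empty 0)), T.sub p = some T' →
      m Δ' ≤ m Δ → T'.root.map (Fml.ground σ) ⊆ Δ' →
      Derives Sk (Tb.root.map (Fml.ground σ)) (p <+: b) False Δ' := by
    intro T'
    induction T' with
    | leaf s => exact fun p Δ' hp _ _ => (hT.closed.sub hp).elim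
    | node0 s r =>
      intro p Δ' hp hmp hsub
      by_cases hpb : p = b
      · subst hpb
        cases hp.symm.trans hb
        exact .of_subset hsub
      have hstep : r.Step Sk s [] := hT.isTableau.valid.sub hp
      have hr : T.ruleAt p = some r := DTree.ruleAt_eq hp
      have hnd : ¬ r.IsDelta := by
        intro hd
        cases r with
        | delta => obtain ⟨-, -, -, -, -, h⟩ := hstep; exact absurd h (by simp)
        | _ => exact hd
      obtain ⟨ps', hgs, hps⟩ := hstep.toGS hnd
        (fun A B e => hT.unifies A B (e ▸ DTree.ruleAt_mem_rules hr)) hsub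
      cases hps
      refine .step0 hgs ?_
      rintro ⟨l, rfl⟩
      rw [DTree.sub_append hp] at hb
      cases l with
      | nil => exact hpb (List.append_nil _).symm
      | cons => exact absurd hb (by simp [DTree.sub])
    | node1 s r t ih =>
      intro p Δ' hp hmp hsub
      by_cases hpb : p = b
      · subst hpb
        cases hp.symm.trans hb
        exact .of_subset hsub
      have hstep : r.Step Sk s [t.root] := (hT.isTableau.valid.sub hp).1
      have hr : T.ruleAt p = some r := DTree.ruleAt_eq hp
      have ht : T.sub (p ++ [false]) = some t := (DTree.sub_append hp _).trans (DTree.sub_nil t)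
      have hpre : p <+: b → p ++ [false] <+: b := by
        rintro ⟨l, rfl⟩
        rw [DTree.sub_append hp] at hb
        rcases l with _ | ⟨_ | _, l⟩
        · exact (hpb (List.append_nil _).symm).elim
        · exact ⟨l, by simp⟩
        · cases hb
      by_cases hd : r.IsDelta
      · cases r with
        | delta A D f a =>
          obtain ⟨-, hA, hf, -, -, hps⟩ := id hstep
          have hps := List.singleton_inj.1 hps
          by_cases hmem : (D.inst (.func f fun i => .var (a i))).ground σ ∈ Δ'
          · refine (ih _ Δ' ht hmp ?_).mono hpre id
            rw [hps, Multiset.map_cons]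
            exact Multiset.cons_subset.2 ⟨hmem, hsub⟩
          · refine (hT.derives_delta hr (hsub (Multiset.mem_map_of_mem _ hA))
              (IH _ (lt_of_lt_of_le ?_ hmp) ?_ rfl)).mono (fun _ => trivial) id
            · refine hm' _ _ p A D _ f a hr hmem (Multiset.mem_cons_self _ _) fun B hB hno => ?_
              exact Multiset.mem_cons_of_mem (Multiset.mem_filter.2 ⟨hB, hno⟩)
            · refine Multiset.Subset.trans (hT.root_subset_filter ?_ hf _)
                (Multiset.subset_cons _ _)
              exact Multiset.Subset.trans
                (Multiset.map_subset_map (hT.isTableau.subset_root hp)) hsub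
        | _ => exact hd.elim
      · obtain ⟨ps', hgs, hps⟩ := hstep.toGS hd
          (fun A B e => hT.unifies A B (e ▸ DTree.ruleAt_mem_rules hr)) hsub
        obtain ⟨Δ₁, _, ⟨h1, h1'⟩, hnil, rfl⟩ := List.forall₂_cons_left_iff.1 hps
        cases hnil
        exact .step1 hgs ((ih _ Δ₁ ht ((hm _ _ h1').trans hmp) h1).mono hpre id)
    | node2 s r t u iht ihu =>
      intro p Δ' hp hmp hsub
      by_cases hpb : p = b
      · subst hpb
        cases hp.symm.trans hb
        exact .of_subset hsub
      have hstep : r.Step Sk s [t.root, u.root] := (hT.isTableau.valid.sub hp).1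
      have hr : T.ruleAt p = some r := DTree.ruleAt_eq hp
      have ht : T.sub (p ++ [false]) = some t := (DTree.sub_append hp _).trans (DTree.sub_nil t)
      have hu : T.sub (p ++ [true]) = some u := (DTree.sub_append hp _).trans (DTree.sub_nil u)
      have hpre : p <+: b → p ++ [false] <+: b ∨ p ++ [true] <+: b := by
        rintro ⟨l, rfl⟩
        rcases l with _ | ⟨_ | _, l⟩
        · exact (hpb (List.append_nil _).symm).elim
        · exact Or.inl ⟨l, by simp⟩
        · exact Or.inr ⟨l, by simp⟩
      have hnd : ¬ r.IsDelta := by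
        intro hd
        cases r with
        | delta => obtain ⟨-, -, -, -, -, h⟩ := hstep; exact absurd h (by simp)
        | _ => exact hd
      obtain ⟨ps', hgs, hps⟩ := hstep.toGS hnd
        (fun A B e => hT.unifies A B (e ▸ DTree.ruleAt_mem_rules hr)) hsub
      obtain ⟨Δ₁, _, ⟨h1, h1'⟩, hps', rfl⟩ := List.forall₂_cons_left_iff.1 hps
      obtain ⟨Δ₂, _, ⟨h2, h2'⟩, hnil, rfl⟩ := List.forall₂_cons_left_iff.1 hps'
      cases hnil
      exact .step2 hgs (iht _ Δ₁ ht ((hm _ _ h1').trans hmp) h1)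
        (ihu _ Δ₂ hu ((hm _ _ h2').trans hmp) h2) hpre
  refine (walk T [] Δ (DTree.sub_nil T) le_rfl ?_).mono (fun _ => List.nil_prefix) id
  rwa [hT.isTableau.root_eq]

end ClosedTableau

/-! ### Parallel extensions by grafting -/

open Classical in
/-- The mapping of a parallel extension: unchanged on the old leaves, and given by `lab` on the
new ones. -/
noncomputable def graftMap (π₀ : GSTree L) (μ₀ : Pos → Pos) (b : Pos) (lab : Pos → Bool) (q : Pos) : Pos :=
  if π₀.IsLeaf q then μ₀ q else b ++ [lab q]

theorem DTree.not_isLeaf_append {S R : Type*} {t : DTree S R} {p l : Pos} (hp : t.IsLeaf p)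
    (hl : l ≠ []) : ¬ t.IsLeaf (p ++ l) := fun h =>
  hl (List.self_eq_append_right.1 (DTree.leafAt_prefix_inj hp h (List.prefix_append _ _)))

theorem isParallelExtension_graft {Sk : ∀ k, Set (L.Functions k)} {σ : V → L.Term Empty}
    {T T₀ : TabTree L V} (hT₀ : T₀.Initial T) {π₀ : GSTree L} (hπ₀ : IsProofTree Sk π₀)
    {μ₀ : Pos → Pos} (hμ₀ : Linked σ π₀ T₀ μ₀) {b : Pos} {ρ : Pos → Multiset (Fml L Empty 0) → GSTree L}
    {lab : Pos → Bool} (hlab : ∀ p l, l ≠ [] → lab (p ++ l) = lab l)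
    (hroot : ∀ p s, π₀.leafAt p = some s → (ρ p s).root = s)
    (hvalid : ∀ p s, π₀.leafAt p = some s → IsProofTree Sk (ρ p s))
    (hne : ∀ p s, π₀.leafAt p = some s → μ₀ p ≠ b → ρ p s = .leaf s)
    (hproper : ∀ p s, π₀.leafAt p = some s → μ₀ p = b → ¬ (ρ p s).IsLeaf [])
    (hleaf : ∀ p s, π₀.leafAt p = some s → μ₀ p = b → ∀ l s', (ρ p s).leafAt l = some s' →
      ∃ Δ, (T₀.extend T b).leafAt (b ++ [lab l]) = some Δ ∧ Δ.map (Fml.ground σ) ⊆ s')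
    (hcover : ∀ p s, π₀.leafAt p = some s → μ₀ p = b → ∀ i, (T₀.extend T b).IsLeaf (b ++ [i]) →
      ∃ l, (ρ p s).IsLeaf l ∧ lab l = i) :
    IsParallelExtension Sk σ π₀ μ₀ b (T₀.extend T b) (π₀.graft ρ) (graftMap π₀ μ₀ b lab) := by
  have hnil : ∀ {p s l s'}, π₀.leafAt p = some s → μ₀ p = b → (ρ p s).leafAt l = some s' →
      l ≠ [] := by
    rintro p s l s' hp hb h rfl
    exact hproper p s hp hb ⟨s', h⟩
  have hnew : ∀ {p s l}, π₀.leafAt p = some s → l ≠ [] →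
      graftMap π₀ μ₀ b lab (p ++ l) = b ++ [lab l] := by
    intro p s l hp hl
    rw [graftMap, if_neg (DTree.not_isLeaf_append ⟨s, hp⟩ hl), hlab p l hl]
  refine ⟨DTree.Valid.graft hπ₀ hroot hvalid, DTree.initial_graft hroot, ⟨?_, ?_⟩, ?_, ?_, ?_, ?_⟩
  · rw [DTree.root_graft hroot, hT₀.root_extend, hμ₀.root_eq]
  · intro q s' h
    obtain ⟨p, s, l, hp, rfl, hl⟩ := DTree.exists_of_leafAt_graft h
    by_cases hb : μ₀ p = b
    · rw [hnew hp (hnil hp hb hl)]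
      exact hleaf p _ hp hb l s' hl
    · rw [hne p s hp hb] at hl
      cases l with
      | cons => cases hl
      | nil =>
        cases hl
        obtain ⟨Δ, hΔ, hs⟩ := hμ₀.leaf p s' hp
        rw [List.append_nil, graftMap, if_pos ⟨s', hp⟩]
        exact ⟨Δ, hT₀.leafAt_extend_of_ne hb hΔ, hs⟩
  · rintro p ⟨s, hp⟩ hb
    refine ⟨s, ?_⟩
    have := DTree.leafAt_graft_append (ρ := ρ) hp []
    rw [List.append_nil, hne p s hp hb] at this
    exact this
  · exact fun p hp _ => if_pos hp
  · rintro q ⟨s', h⟩ hq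
    obtain ⟨p, s, l, hp, rfl, hl⟩ := DTree.exists_of_leafAt_graft h
    by_cases hb : μ₀ p = b
    · exact ⟨⟨p, ⟨s, hp⟩, hb, List.prefix_append _ _⟩, lab l, hnew hp (hnil hp hb hl)⟩
    · rw [hne p s hp hb] at hl
      cases l with
      | cons => cases hl
      | nil => rw [List.append_nil] at hq; exact (hq ⟨s, hp⟩).elim
  · rintro p ⟨s, hp⟩ hb i hi
    obtain ⟨l, ⟨s', hl⟩, rfl⟩ := hcover p s hp hb i hi
    refine ⟨p ++ l, ⟨s', ?_⟩, List.prefix_append _ _, hnew hp (hnil hp hb hl)⟩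
    rw [DTree.leafAt_graft_append hp, hl]

/-- The first inference of a subtree of a closed tableau, if it is not a `δ`-inference, can be
performed directly in GS3. -/
theorem IsClosedTableau.exists_direct {Sk : ∀ k, Set (L.Functions k)} {Γ : Multiset (Fml L V 0)}
    {T : TabTree L V} {σ : V → L.Term Empty} (hT : IsClosedTableau Sk Γ T σ) {b : Pos}
    {Tb : TabTree L V} (hb : T.sub b = some Tb) {r : TabRule L V} (hr : T.ruleAt b = some r)
    (hd : ¬ r.IsDelta) {Δ : Multiset (Fml L Empty 0)} (hΔ : Tb.root.map (Fml.ground σ) ⊆ Δ) :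
    ∃ π : GSTree L, π.root = Δ ∧ IsProofTree Sk π ∧ π.ruleAt [] = some (r.toGS σ) ∧
      (∀ l s, π.leafAt l = some s → ∃ i Δb, l = [i] ∧ Tb.firstStep.leafAt [i] = some Δb ∧
        Δb.map (Fml.ground σ) ⊆ s) ∧
      ∀ i, Tb.firstStep.IsLeaf [i] → π.IsLeaf [i] := by
  have hu := fun A B (e : r = .closure A B) => hT.unifies A B (e ▸ DTree.ruleAt_mem_rules hr)
  have hv := hT.isTableau.valid.sub hb
  rw [DTree.ruleAt_eq hb] at hr
  cases Tb with
  | leaf => cases hr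
  | node0 s r' =>
    cases hr
    obtain ⟨ps', hgs, hps⟩ := TabRule.Step.toGS hd hu hv hΔ
    cases hps
    refine ⟨.node0 Δ _, rfl, hgs, rfl, fun l s h => ?_, ?_⟩
    · cases l <;> cases h
    · rintro i ⟨s, h⟩
      cases h
  | node1 s r' t =>
    cases hr
    obtain ⟨ps', hgs, hps⟩ := TabRule.Step.toGS hd hu hv.1 hΔ
    obtain ⟨Δ₁, _, ⟨h1, -⟩, hnil, rfl⟩ := List.forall₂_cons_left_iff.1 hps
    cases hnil
    refine ⟨.node1 Δ _ (.leaf Δ₁), rfl, ⟨hgs, trivial⟩, rfl, fun l s h => ?_, ?_⟩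
    · rcases l with _ | ⟨_ | _, _ | ⟨_, l⟩⟩ <;> cases h
      exact ⟨false, t.root, rfl, rfl, h1⟩
    · rintro (_ | _) ⟨s, h⟩
      · exact ⟨Δ₁, rfl⟩
      · cases h
  | node2 s r' t u =>
    cases hr
    obtain ⟨ps', hgs, hps⟩ := TabRule.Step.toGS hd hu hv.1 hΔ
    obtain ⟨Δ₁, _, ⟨h1, -⟩, hps', rfl⟩ := List.forall₂_cons_left_iff.1 hps
    obtain ⟨Δ₂, _, ⟨h2, -⟩, hnil, rfl⟩ := List.forall₂_cons_left_iff.1 hps'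
    cases hnil
    refine ⟨.node2 Δ _ (.leaf Δ₁) (.leaf Δ₂), rfl, ⟨hgs, trivial, trivial⟩, rfl,
      fun l s h => ?_, ?_⟩
    · rcases l with _ | ⟨_ | _, _ | ⟨_, l⟩⟩ <;> cases h
      · exact ⟨false, t.root, rfl, rfl, h1⟩
      · exact ⟨true, u.root, rfl, rfl, h2⟩
    · rintro (_ | _) -
      · exact ⟨Δ₁, rfl⟩
      · exact ⟨Δ₂, rfl⟩

end FVTab

theorem mainTheorem3 {L : FirstOrder.Language} {V : Type*}
    (Sk : ∀ k, Set (L.Functions k))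
    (Γ : Multiset (FVTab.Fml L V 0)) (T : FVTab.TabTree L V) (σ : V → L.Term Empty)
    (hT : FVTab.IsClosedTableau Sk Γ T σ)
    (T₀ : FVTab.TabTree L V) (hT₀ : T₀.Initial T)
    (π₀ : FVTab.GSTree L) (hπ₀ : FVTab.IsProofTree Sk π₀)
    (μ₀ : FVTab.Pos → FVTab.Pos) (hμ₀ : FVTab.Linked σ π₀ T₀ μ₀)
    (b : FVTab.Pos) (hb : T₀.IsLeaf b) :
    ∃ r, T.ruleAt b = some r ∧
      ∃ (π₁ : FVTab.GSTree L) (μ₁ : FVTab.Pos → FVTab.Pos),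
        FVTab.IsParallelExtension Sk σ π₀ μ₀ b (T₀.extend T b) π₁ μ₁ ∧
        (¬ r.IsDelta → FVTab.IsDirect σ π₀ μ₀ b r (T₀.extend T b) π₁ μ₁) := by
  classical
  open FVTab in
  obtain ⟨Δb, hΔb⟩ := id hb
  obtain ⟨Tb, hTb, rfl⟩ := hT₀.exists_sub hΔb
  obtain ⟨r, hr⟩ : ∃ r, T.ruleAt b = some r := by
    rw [DTree.ruleAt_eq hTb]
    have := hT.closed.sub hTb
    cases Tb with
    | leaf => exact this.elim
    | _ => exact ⟨_, rfl⟩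
  have hext := hT₀.leafAt_extend_append hb hTb
  have hlink : ∀ {p s}, π₀.leafAt p = some s → μ₀ p = b → Tb.root.map (Fml.ground σ) ⊆ s := by
    intro p s hp hpb
    obtain ⟨Δ, hΔ, hs⟩ := hμ₀.leaf p s hp
    rw [hpb, hΔb] at hΔ
    cases hΔ
    exact hs
  refine ⟨r, hr, ?_⟩
  by_cases hd : r.IsDelta
  · cases r with
    | delta A D f a =>
      obtain ⟨s₀, t, hTb', -, hA, hf, -, -, -⟩ := hT.isTableau.exists_of_ruleAt_delta hr
      cases hTb'.symm.trans hTb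
      have H : ∀ p s, ∃ π : GSTree L, π₀.leafAt p = some s → π.root = s ∧ IsProofTree Sk π ∧
          (μ₀ p ≠ b → π = .leaf s) ∧ (μ₀ p = b → (∀ q s', π.leafAt q = some s' →
            t.root.map (Fml.ground σ) ⊆ s') ∧ (∃ q, π.IsLeaf q) ∧ ¬ π.IsLeaf []) := by
        intro p s
        by_cases hp : π₀.leafAt p = some s
        swap
        · exact ⟨.leaf s, fun h => (hp h).elim⟩
        by_cases hpb : μ₀ p = b
        swap
        · exact ⟨.leaf s, fun _ => ⟨rfl, trivial, fun _ => rfl, fun h => (hpb h).elim⟩⟩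
        have hsub := hlink hp hpb
        have hΓ : Γ.map (Fml.ground σ) ⊆ s :=
          Multiset.Subset.trans (Multiset.map_subset_map (hT.isTableau.subset_root hTb)) hsub
        obtain ⟨π, h1, h2, h3, h4, h5⟩ := hT.derives_delta (proper := True) hr
          (hsub (Multiset.mem_map_of_mem _ hA))
          (hT.derives ((DTree.sub_append hTb [false]).trans (DTree.sub_nil t))
            (Multiset.Subset.trans (hT.root_subset_filter hΓ hf _) (Multiset.subset_cons _ _)))
        exact ⟨π, fun _ => ⟨h1, h2, fun h => (h hpb).elim, fun _ => ⟨h3, h4 trivial, h5 trivial⟩⟩⟩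
      choose ρ hρ using H
      refine ⟨π₀.graft ρ, graftMap π₀ μ₀ b fun _ => false, isParallelExtension_graft hT₀ hπ₀ hμ₀
        (fun _ _ _ => rfl) (fun p s h => (hρ p s h).1) (fun p s h => (hρ p s h).2.1)
        (fun p s h => (hρ p s h).2.2.1) (fun p s h hb => ((hρ p s h).2.2.2 hb).2.2) ?_ ?_,
        fun h => (h hd).elim⟩
      · intro p s hp hpb l s' hl
        exact ⟨t.root, hext [false], ((hρ p s hp).2.2.2 hpb).1 l s' hl⟩
      · rintro p s hp hpb i ⟨s', hi⟩
        obtain ⟨q, hq⟩ := ((hρ p s hp).2.2.2 hpb).2.1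
        refine ⟨q, hq, ?_⟩
        cases i with
        | false => rfl
        | true => rw [hext] at hi; cases hi
    | _ => exact hd.elim
  · have H : ∀ p s, ∃ π : GSTree L, π₀.leafAt p = some s → π.root = s ∧ IsProofTree Sk π ∧
        (μ₀ p ≠ b → π = .leaf s) ∧ (μ₀ p = b → π.ruleAt [] = some (r.toGS σ) ∧
          (∀ l s', π.leafAt l = some s' → ∃ i Δb, l = [i] ∧ Tb.firstStep.leafAt [i] = some Δb ∧
            Δb.map (Fml.ground σ) ⊆ s') ∧ ∀ i, Tb.firstStep.IsLeaf [i] → π.IsLeaf [i]) := by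
      intro p s
      by_cases hp : π₀.leafAt p = some s
      swap
      · exact ⟨.leaf s, fun h => (hp h).elim⟩
      by_cases hpb : μ₀ p = b
      swap
      · exact ⟨.leaf s, fun _ => ⟨rfl, trivial, fun _ => rfl, fun h => (hpb h).elim⟩⟩
      obtain ⟨π, h1, h2, h3, h4⟩ := hT.exists_direct hTb hr hd (hlink hp hpb)
      exact ⟨π, fun _ => ⟨h1, h2, fun h => (h hpb).elim, fun _ => ⟨h3, h4⟩⟩⟩
    choose ρ hρ using H
    have hcov : ∀ p s, π₀.leafAt p = some s → μ₀ p = b → ∀ i,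
        (T₀.extend T b).IsLeaf (b ++ [i]) → (ρ p s).IsLeaf [i] := by
      rintro p s hp hpb i ⟨s', hi⟩
      rw [hext] at hi
      exact ((hρ p s hp).2.2.2 hpb).2.2 i ⟨s', hi⟩
    have hlab : ∀ p l : Pos, l ≠ [] → (p ++ l).getLastD false = l.getLastD false := by
      intro p l hl
      rw [List.getLastD_eq_getLast?, List.getLastD_eq_getLast?, List.getLast?_append_of_ne_nil _ hl]
    refine ⟨π₀.graft ρ, graftMap π₀ μ₀ b fun l => l.getLastD false,
      isParallelExtension_graft hT₀ hπ₀ hμ₀ hlab (fun p s h => (hρ p s h).1)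
        (fun p s h => (hρ p s h).2.1) (fun p s h => (hρ p s h).2.2.1) ?_ ?_
        (fun p s hp hpb i hi => ⟨[i], hcov p s hp hpb i hi, rfl⟩), ?_⟩
    · rintro p s hp hpb ⟨s', h⟩
      obtain ⟨i, Δ, h, -⟩ := ((hρ p s hp).2.2.2 hpb).2.1 [] s' h
      cases h
    · intro p s hp hpb l s' hl
      obtain ⟨i, Δ, rfl, h, hs⟩ := ((hρ p s hp).2.2.2 hpb).2.1 l s' hl
      exact ⟨Δ, (hext [i]).trans h, hs⟩
    · rintro - p ⟨s, hp⟩ hpb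
      refine ⟨(DTree.ruleAt_graft hp).trans ((hρ p s hp).2.2.2 hpb).1, fun i hi => ?_⟩
      obtain ⟨s', hs'⟩ := hcov p s hp hpb i hi
      refine ⟨⟨s', (DTree.leafAt_graft_append hp [i]).trans hs'⟩, ?_⟩
      rw [graftMap, if_neg (DTree.not_isLeaf_append ⟨s, hp⟩ (List.cons_ne_nil i [])),
        hlab p [i] (List.cons_ne_nil i [])]
      rfl
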